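/- **Setting.** A finite walk of length $L(\omega)=k$ is a sequence $\omega=(\omega(0),\dots,\omega(k))$ of integers with $\omega(0)=0$ and $|\omega(i)-\omega(i+1)|=1$. Let $T_0^M(\omega)=0$ and, for $i\ge 1$, let $T_i^M(\omega)$ be the least $j>T_{i-1}^M(\omega)$ with $\omega(j)\in 2^M\mathbb Z\setminus\{\omega(T_{i-1}^M(\omega))\}$ ($+\infty$ if there is none). Let $2^{-M}Q_M\omega$ be the walk $i\mapsto 2^{-M}\omega(T_i^M(\omega))$, of length $\max\{i:T_i^M(\omega)<\infty\}$. For $N\ge1$ let $W_{N,\pm}$ be the set of finite walks $\omega$ with $L(\omega)=T_1^N(\omega)$ and $\omega(L(\omega))=\pm2^N$. For $u\ge 0$ put $x_u=\dfrac{2}{1+\sqrt{1+8u^2}}$ and define, with $0^0=1$, $$P^u_{1,+}(\{\omega\})=u^{L(\omega)-2}x_u^{L(\omega)-1}\quad(\omega\in W_{1,+}),$$ $$P^u_{N+1,+}(\{\omega\})=P^u_{1,+}(\{\omega'\})\prod_{j=1}^{L(\omega')}P^u_{N,+}(\{\widetilde\omega_j\})\quad(\omega\in W_{N+1,+}),$$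 where $\omega'=2^{-N}Q_N\omega$ and $\widetilde\omega_j\in W_{N,+}$ is the piece of $\omega$ between the times $T_{j-1}^N(\omega)$ and $T_j^N(\omega)$, translated to start at $0$ and multiplied by the sign of $\omega(T_j^N(\omega))-\omega(T_{j-1}^N(\omega))$. For $\omega\in W_{N,-}$ let $P^u_{N,-}(\{\omega\})=P^u_{N,+}(\{-\omega\})$. Let $W_\infty$ be the set of infinite nearest-neighbour walks on $\mathbb Z$ started at $0$, with the $\sigma$-algebra generated by the cylinder sets. The law $P^u$ of the Denker–Hattori self-interacting walk is a probability measure on $W_\infty$ such that, for all $N\ge1$ and all $\widetilde\omega\in W_{N,\pm}$, $$P^u(\{\omega:\omega(j)=\widetilde\omega(j),\ 0\le j\le L(\widetilde\omega)\})=\tfrac12P^u_{N,\pm}(\{\widetilde\omega\}).$$ For $n\ge 1$ let $R_n(\omega)$ be the number of points that $\omega\in W_\infty$ visits before it hits $\{\pm2^n\}$. **Theorem 1.2.** Let $u\ge0$. A measure $P^u$ as above exists, and there is a probability measure $\widetilde P^u$ on $[0,1]$, depending only on $u$, with distribution function $f_u$, such that the following hold. 1. Under $P^u$, the random variables $R_n/2^n-1$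 converge weakly to $\widetilde P^u$ as $n\to\infty$. 2. If $u>0$, then $f=f_u$ satisfies $$f(x)=\begin{cases}\Phi(A_{u,0};f(2x)),&0\le x\le 1/2,\\ \Phi(A_{u,1};f(2x-1)),&1/2\le x\le1,\end{cases}\tag{1.1}$$ where $\Phi(A;z)=\dfrac{az+b}{cz+d}$ for $A=\begin{pmatrix}a&b\\c&d\end{pmatrix}$, the denominators occurring in (1.1) do not vanish, and $$A_{u,0}=\begin{pmatrix}x_u&0\\-u^2x_u^2&1\end{pmatrix},\qquad A_{u,1}=\begin{pmatrix}0&x_u\\-u^2x_u^2&1-u^2x_u^2\end{pmatrix}.$$ 3. If $u=1$, then $\widetilde P^u$ is absolutely continuous with respect to Lebesgue measure on $[0,1]$. If $u\ne1$, then $\widetilde P^u$ is singular with respect to Lebesgue measure on $[0,1]$. -/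

import Mathlib

open MeasureTheory ProbabilityTheory Set Filter Topology

/-- A finite integer sequence `(pos 0, pos 1, …, pos len)`. Only the values of `pos` at the
times `0, …, len` carry information; every notion below looks at these values only. -/
structure FinPath where
  len : ℕ
  pos : ℕ → ℤ

namespace FinPath

/-- Membership in `W*`: the sequence starts at `0` and makes nearest-neighbour steps. -/
def IsWalk (ω : FinPath) : Prop :=
  ω.pos 0 = 0 ∧ ∀ i < ω.len, |ω.pos i - ω.pos (i + 1)| = 1

/-- The times `T_i^M`: `T_0^M = 0`, and `T_{i+1}^M` is the least `j` with `T_i^M < j ≤ len`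
such that `ω(j)` lies in `2^M ℤ` and differs from `ω(T_i^M)`; it is `⊤` if there is none. -/
noncomputable def decTime (M : ℕ) (ω : FinPath) : ℕ → ℕ∞
  | 0 => 0
  | i + 1 => sInf {t : ℕ∞ | ∃ j : ℕ, t = (j : ℕ∞) ∧ decTime M ω i < (j : ℕ∞) ∧ j ≤ ω.len ∧
      (2 : ℤ) ^ M ∣ ω.pos j ∧ ω.pos j ≠ ω.pos (decTime M ω i).toNat}

/-- The decimated and rescaled path `2^{-M} Q_M ω`, that is `i ↦ 2^{-M} ω(T_i^M)`, of length
`max {i | T_i^M < ∞}`. -/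
noncomputable def decimate (M : ℕ) (ω : FinPath) : FinPath where
  len := sSup {i : ℕ | ω.decTime M i < ⊤}
  pos := fun i => ω.pos (ω.decTime M i).toNat / (2 : ℤ) ^ M

/-- The signed `j`-th segment (`j ≥ 1`) of `ω` at level `N`: the piece of `ω` between the times
`T_{j-1}^N` and `T_j^N`, translated to start at `0` and multiplied by the sign of its total
displacement. -/
noncomputable def segment (N j : ℕ) (ω : FinPath) : FinPath where
  len := (ω.decTime N j).toNat - (ω.decTime N (j - 1)).toNat
  pos := fun t =>
    Int.sign (ω.pos (ω.decTime N j).toNat - ω.pos (ω.decTime N (j - 1)).toNat) *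
      (ω.pos ((ω.decTime N (j - 1)).toNat + t) - ω.pos (ω.decTime N (j - 1)).toNat)

/-- The reflected path `-ω`. -/
def neg (ω : FinPath) : FinPath where
  len := ω.len
  pos := fun t => -ω.pos t

/-- Membership in `W_{N,+}`: a walk stopped at `T_1^N`, where it sits at `2^N`. -/
def MemPlus (N : ℕ) (ω : FinPath) : Prop :=
  ω.IsWalk ∧ (ω.len : ℕ∞) = ω.decTime N 1 ∧ ω.pos ω.len = 2 ^ N

/-- Membership in `W_{N,-}`: a walk stopped at `T_1^N`, where it sits at `-2^N`. -/
def MemMinus (N : ℕ) (ω : FinPath) : Prop :=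
  ω.IsWalk ∧ (ω.len : ℕ∞) = ω.decTime N 1 ∧ ω.pos ω.len = -2 ^ N

end FinPath

/-- `x_u = 2 / (1 + √(1 + 8 u²))`. -/
noncomputable def xParam (u : ℝ) : ℝ := 2 / (1 + Real.sqrt (1 + 8 * u ^ 2))

/-- The mass `P_{N,+}^u({ω})` of `ω ∈ W_{N,+}`, `N ≥ 1`. At level `1` it is
`u^{L(ω)-2} x_u^{L(ω)-1}` with `0^0 = 1`; at level `N + 1` it is
`P_{1,+}^u({ω'})` times the product over `1 ≤ j ≤ L(ω')` of the masses under `P_{N,+}^u` of the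
signed segments, where `ω' = 2^{-N} Q_N ω`. Level `0` is not used. -/
noncomputable def massPlus (u : ℝ) : ℕ → FinPath → ℝ
  | 0, _ => 1
  | 1, ω => u ^ (ω.len - 2) * xParam u ^ (ω.len - 1)
  | N + 2, ω =>
      massPlus u 1 (ω.decimate (N + 1)) *
        ∏ j ∈ Finset.Icc 1 (ω.decimate (N + 1)).len, massPlus u (N + 1) (ω.segment (N + 1) j)

/-- The mass `P_{N,-}^u({ω}) = P_{N,+}^u({-ω})` of `ω ∈ W_{N,-}`. -/
noncomputable def massMinus (u : ℝ) (N : ℕ) (ω : FinPath) : ℝ := massPlus u N ω.neg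

/-- The space `W_∞` of infinite nearest-neighbour paths on `ℤ` started at `0`. Its σ-algebra, the
trace of the product σ-algebra, is the one generated by the cylinder sets. -/
abbrev InfWalk : Type :=
  {ω : ℕ → ℤ // ω 0 = 0 ∧ ∀ i, |ω i - ω (i + 1)| = 1}

/-- The set of infinite walks whose initial piece is `ω`. -/
def cylinderOf (ω : FinPath) : Set InfWalk :=
  {η | ∀ j ≤ ω.len, η.1 j = ω.pos j}

/-- `P` is the law `P^u` of the Denker–Hattori self-interacting walk with parameter `u`: a
probability measure on `W_∞` that gives the cylinder over each `ω ∈ W_{N,±}`, `N ≥ 1`, the mass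
`P_{N,±}^u({ω}) / 2`. -/
def IsDenkerHattoriLaw (u : ℝ) (P : ProbabilityMeasure InfWalk) : Prop :=
  ∀ N : ℕ, 1 ≤ N → ∀ ω : FinPath,
    (ω.MemPlus N →
      (P : Measure InfWalk) (cylinderOf ω) = ENNReal.ofReal (massPlus u N ω / 2)) ∧
    (ω.MemMinus N →
      (P : Measure InfWalk) (cylinderOf ω) = ENNReal.ofReal (massMinus u N ω / 2))

/-- `R_n(ω)`: the number of points that `ω` visits before it hits `{2^n, -2^n}`. -/
noncomputable def walkRange (n : ℕ) (ω : InfWalk) : ℕ :=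
  Set.ncard {x : ℤ | ∃ j : ℕ, ω.1 j = x ∧ ∀ i ≤ j, ω.1 i ≠ 2 ^ n ∧ ω.1 i ≠ -2 ^ n}

/-- The denominator `c z + d` of `Φ(A; z)`. -/
def moebiusDenom (A : Matrix (Fin 2) (Fin 2) ℝ) (z : ℝ) : ℝ := A 1 0 * z + A 1 1

/-- `Φ(A; z) = (a z + b) / (c z + d)` for `A = !![a, b; c, d]`. -/
noncomputable def moebius (A : Matrix (Fin 2) (Fin 2) ℝ) (z : ℝ) : ℝ :=
  (A 0 0 * z + A 0 1) / moebiusDenom A z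

/-- The matrix `A_{u,0}`. -/
noncomputable def deRhamMatrix0 (u : ℝ) : Matrix (Fin 2) (Fin 2) ℝ :=
  !![xParam u, 0; -(u ^ 2 * xParam u ^ 2), 1]

/-- The matrix `A_{u,1}`. -/
noncomputable def deRhamMatrix1 (u : ℝ) : Matrix (Fin 2) (Fin 2) ℝ :=
  !![0, xParam u; -(u ^ 2 * xParam u ^ 2), 1 - u ^ 2 * xParam u ^ 2]

/-- `f` satisfies on `[0,1]` the functional equation `f(x) = Φ(A_{u,0}; f(2x))` for
`0 ≤ x ≤ 1/2` and `f(x) = Φ(A_{u,1}; f(2x-1))` for `1/2 ≤ x ≤ 1`; the quotients have to be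
genuine, that is, their denominators do not vanish. -/
def SatisfiesDeRham (u : ℝ) (f : ℝ → ℝ) : Prop :=
  (∀ x ∈ Icc (0 : ℝ) (1 / 2),
    moebiusDenom (deRhamMatrix0 u) (f (2 * x)) ≠ 0 ∧
      f x = moebius (deRhamMatrix0 u) (f (2 * x))) ∧
  (∀ x ∈ Icc (1 / 2 : ℝ) 1,
    moebiusDenom (deRhamMatrix1 u) (f (2 * x - 1)) ≠ 0 ∧
      f x = moebius (deRhamMatrix1 u) (f (2 * x - 1)))

/-! Write `x = x_u`. Cut at its visits to `2^N ℤ`, a path of level `N + 1` is, in exactly one way, a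
sequence of excursions `0 → ±2^N → 0` followed by a passage `0 → 2^N → 2^(N+1)`. An excursion
contributes `u² x²` and the final passage `x`, times the masses of the level-`N` pieces. `PathTree`
encodes this splitting. Since `2 u² x² + x = 1` (`xParam_quadratic`), the number of excursions is
geometric and the masses sum to one. The law exists because the masses of consecutive levels are
consistent (`measure_cyl_of_succ`) and the path space is compact.

Before hitting `±2^N` a path visits, up to reflection, an interval `[-low, 2^N - 1]`, so the
rescaled excess range is `low / 2^N`. A right excursion or the final passage contributes half the
rescaled depth `d` of its first piece, a left excursion contributes `(1 + d) / 2` with `d` the depth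
of its second piece, and the total depth is the maximum. Hence the event "depth at most `y`"
factorizes over excursions, and a geometric series gives `F_{N+1}` from `F_N` by the two Möbius maps
(`tsum_massLe`). These maps are increasing, so `F_N` decreases to a limit distribution function `f`
that solves (1.1).

For `u = 1`, `f(y) = 2y / (1 + y)`, which is Lipschitz. For `u = 0` the law is the point mass at
`0`. In the remaining cases suppose `f` has a nonzero derivative at `t`. On the dyadic intervals
around `t`, `f` is a copy of itself distorted by `z ↦ D z / (1 + ρ z)`, and the share of the left
half is a function of `ρ` alone. This share has to tend to `1/2`, so `ρ` converges. Infinitely many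
moves are to the left, and they act by `ρ ↦ x ρ - (1 - x) / 2`, whose fixed point is `-1/2`. The
share at `ρ = -1/2` is `1/2` only if `x = 1/2`, that is `u = 1` (`limitCdf_deriv_eq_zero`). So
otherwise the derivative vanishes almost everywhere. -/

open scoped ENNReal

/-! ### The two branch maps -/

/-- The branch map on the left half, as a function of the parameter `x = x_u`. -/
noncomputable def leftBranch (x z : ℝ) : ℝ := x * z / (1 - (1 - x) / 2 * z)

/-- The branch map on the right half, as a function of the parameter `x = x_u`. -/
noncomputable def rightBranch (x z : ℝ) : ℝ := x / (1 - (1 - x) / 2 * (1 + z))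

section Branches

variable {x : ℝ}

lemma leftBranch_zero (x : ℝ) : leftBranch x 0 = 0 := by simp [leftBranch]

lemma leftBranch_one_eq_rightBranch_zero (x : ℝ) : leftBranch x 1 = rightBranch x 0 := by
  simp [leftBranch, rightBranch]

lemma rightBranch_one (hx0 : 0 < x) : rightBranch x 1 = 1 := by
  have : 1 - (1 - x) / 2 * (1 + 1) = x := by ring
  rw [rightBranch, this, div_self hx0.ne']

lemma leftBranch_denom_pos (hx0 : 0 < x) {z : ℝ} (hz : z ∈ Icc (0 : ℝ) 1) : 0 < 1 -
    (1 - x) / 2 * z := by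
  nlinarith [hz.1, hz.2]

lemma rightBranch_denom_pos (hx0 : 0 < x) {z : ℝ} (hz : z ∈ Icc (0 : ℝ) 1) :
    0 < 1 - (1 - x) / 2 * (1 + z) := by
  nlinarith [hz.1, hz.2]

lemma leftBranch_mono (hx0 : 0 < x) (hx1 : x ≤ 1) {z w : ℝ} (hw : w ∈ Icc (0 : ℝ) 1) (h : z ≤ w) :
    leftBranch x z ≤ leftBranch x w := by
  have h1 := leftBranch_denom_pos hx0 hw
  have h2 : (1 - x) / 2 * z ≤ (1 - x) / 2 * w := mul_le_mul_of_nonneg_left h (by linarith)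
  unfold leftBranch
  have := hw.1
  gcongr

lemma rightBranch_mono (hx0 : 0 < x) (hx1 : x ≤ 1) {z w : ℝ} (hw : w ∈ Icc (0 : ℝ) 1) (h : z ≤ w) :
    rightBranch x z ≤ rightBranch x w := by
  have h1 := rightBranch_denom_pos hx0 hw
  have h2 : (1 - x) / 2 * (1 + z) ≤ (1 - x) / 2 * (1 + w) :=
    mul_le_mul_of_nonneg_left (by linarith) (by linarith)
  unfold rightBranch
  gcongr

lemma leftBranch_one_le (hx0 : 0 < x) (hx1 : x ≤ 1) : leftBranch x 1 ≤ 1 := by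
  rw [leftBranch_one_eq_rightBranch_zero, ← rightBranch_one hx0]
  exact rightBranch_mono hx0 hx1 (by simp) zero_le_one

lemma leftBranch_mem (hx0 : 0 < x) (hx1 : x ≤ 1) {z : ℝ} (hz : z ∈ Icc (0 : ℝ) 1) :
    leftBranch x z ∈ Icc (0 : ℝ) 1 := by
  constructor
  · rw [← leftBranch_zero x]
    exact leftBranch_mono hx0 hx1 hz hz.1
  · exact (leftBranch_mono hx0 hx1 (by simp) hz.2).trans (leftBranch_one_le hx0 hx1)

lemma leftBranch_le_rightBranch (hx0 : 0 < x) (hx1 : x ≤ 1) {z w : ℝ} (hz : z ∈ Icc (0 : ℝ) 1)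
    (hw : w ∈ Icc (0 : ℝ) 1) :
    leftBranch x z ≤ rightBranch x w :=
  (leftBranch_mono hx0 hx1 (by simp) hz.2).trans
    ((leftBranch_one_eq_rightBranch_zero x).trans_le (rightBranch_mono hx0 hx1 hw hw.1))

lemma rightBranch_mem (hx0 : 0 < x) (hx1 : x ≤ 1) {z : ℝ} (hz : z ∈ Icc (0 : ℝ) 1) :
    rightBranch x z ∈ Icc (0 : ℝ) 1 := by
  constructor
  · rw [← leftBranch_zero x]
    exact leftBranch_le_rightBranch hx0 hx1 (by simp) hz
  · rw [← rightBranch_one hx0]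
    exact rightBranch_mono hx0 hx1 (by simp) hz.2

lemma leftBranch_continuousAt (hx0 : 0 < x) {z : ℝ} (hz : z ∈ Icc (0 : ℝ) 1) :
    ContinuousAt (leftBranch x) z := by
  have := (leftBranch_denom_pos hx0 hz).ne'
  unfold leftBranch
  fun_prop (disch := assumption)

lemma rightBranch_continuousAt (hx0 : 0 < x) {z : ℝ} (hz : z ∈ Icc (0 : ℝ) 1) :
    ContinuousAt (rightBranch x) z := by
  have := (rightBranch_denom_pos hx0 hz).ne'
  unfold rightBranch
  fun_prop (disch := assumption)

end Branches

/-! ### The approximating distribution functions and their limit -/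

/-- The distribution function of the rescaled excess range at level `n`. -/
noncomputable def approxCdf (x : ℝ) : ℕ → ℝ → ℝ
  | 0, y => if 0 ≤ y then 1 else 0
  | n + 1, y =>
      if y < 1 / 2 then leftBranch x (approxCdf x n (2 * y))
      else rightBranch x (approxCdf x n (2 * y - 1))

section Approx

variable {x : ℝ}

lemma approxCdf_mem (hx0 : 0 < x) (hx1 : x ≤ 1) (n : ℕ) (y : ℝ) : approxCdf x n y ∈ Icc
    (0 : ℝ) 1 := by
  induction n generalizing y with
  | zero => unfold approxCdf; split_ifs <;> simp
  | succ n ih =>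
    unfold approxCdf
    split_ifs
    · exact leftBranch_mem hx0 hx1 (ih _)
    · exact rightBranch_mem hx0 hx1 (ih _)

lemma approxCdf_of_neg (n : ℕ) {y : ℝ} (hy : y < 0) : approxCdf x n y = 0 := by
  induction n generalizing y with
  | zero => simp [approxCdf, hy]
  | succ n ih =>
    rw [approxCdf, if_pos (by linarith), ih (by linarith), leftBranch_zero]

lemma approxCdf_of_one_le (hx0 : 0 < x) (n : ℕ) {y : ℝ} (hy : 1 ≤ y) : approxCdf x n y = 1 := by
  induction n generalizing y with
  | zero => simp [approxCdf, zero_le_one.trans hy]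
  | succ n ih =>
    rw [approxCdf, if_neg (by linarith), ih (by linarith), rightBranch_one hx0]

lemma approxCdf_mono (hx0 : 0 < x) (hx1 : x ≤ 1) (n : ℕ) : Monotone (approxCdf x n) := by
  induction n with
  | zero =>
    intro y z h
    unfold approxCdf
    split_ifs with h1 h2
    · exact le_rfl
    · exact absurd (h1.trans h) h2
    · exact zero_le_one
    · exact le_rfl
  | succ n ih =>
    intro y z h
    unfold approxCdf
    split_ifs with h1 h2 h2
    · exact leftBranch_mono hx0 hx1 (approxCdf_mem hx0 hx1 _ _)
        (ih (by linarith))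
    · exact leftBranch_le_rightBranch hx0 hx1 (approxCdf_mem hx0 hx1 _ _)
        (approxCdf_mem hx0 hx1 _ _)
    · linarith
    · exact rightBranch_mono hx0 hx1 (approxCdf_mem hx0 hx1 _ _) (ih (by linarith))

/-- The recursion is monotone in its input, so the inequality propagates from level `0`, where the
function is the largest one vanishing on the negative axis and bounded by `1`. -/
lemma approxCdf_antitone (hx0 : 0 < x) (hx1 : x ≤ 1) (y : ℝ) :
    Antitone fun n => approxCdf x n y := by
  refine antitone_nat_of_succ_le fun n => ?_
  induction n generalizing y with
  | zero =>
    by_cases hy : 0 ≤ y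
    · have h : approxCdf x 0 y = 1 := by simp [approxCdf, hy]
      rw [h]
      exact (approxCdf_mem hx0 hx1 _ _).2
    · rw [approxCdf_of_neg _ (not_le.1 hy), approxCdf_of_neg _ (not_le.1 hy)]
  | succ n ih =>
    rw [approxCdf]
    conv_rhs => rw [approxCdf]
    split_ifs
    · exact leftBranch_mono hx0 hx1 (approxCdf_mem hx0 hx1 _ _) (ih _)
    · exact rightBranch_mono hx0 hx1 (approxCdf_mem hx0 hx1 _ _) (ih _)

lemma approxCdf_rightContinuous (hx0 : 0 < x) (hx1 : x ≤ 1) (n : ℕ) (y : ℝ) :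
    ContinuousWithinAt (approxCdf x n) (Ici y) y := by
  induction n generalizing y with
  | zero =>
    by_cases hy : 0 ≤ y
    · refine (continuousWithinAt_const (b := (1 : ℝ))).congr (fun z hz => ?_) ?_
      · simp [approxCdf, hy.trans hz]
      · simp [approxCdf, hy]
    · refine ContinuousAt.continuousWithinAt ?_
      refine (continuousAt_const (y := (0 : ℝ))).congr ?_
      filter_upwards [Iio_mem_nhds (not_le.1 hy)] with z hz
      exact (approxCdf_of_neg 0 hz).symm
  | succ n ih =>
    by_cases hy : y < 1 / 2
    · have h1 : ContinuousWithinAt (fun z => leftBranch x (approxCdf x n (2 * z))) (Ici y) y := by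
        refine ContinuousAt.comp_continuousWithinAt (f := fun z => approxCdf x n (2 * z))
          (leftBranch_continuousAt hx0 (approxCdf_mem hx0 hx1 _ _)) ?_
        refine ContinuousWithinAt.comp (t := Ici (2 * y)) (f := fun z => 2 * z) (ih _)
          (by fun_prop) fun z hz => ?_
        have : y ≤ z := hz
        simpa using this
      refine h1.congr_of_eventuallyEq ?_ ?_
      · filter_upwards [mem_nhdsWithin_of_mem_nhds (Iio_mem_nhds hy)] with z hz
        rw [approxCdf, if_pos (show z < 1 / 2 from hz)]
      · rw [approxCdf, if_pos hy]
    · have h1 : ContinuousWithinAt (fun z => rightBranch x (approxCdf x n (2 * z - 1)))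
          (Ici y) y := by
        refine ContinuousAt.comp_continuousWithinAt (f := fun z => approxCdf x n (2 * z - 1))
          (rightBranch_continuousAt hx0 (approxCdf_mem hx0 hx1 _ _)) ?_
        refine ContinuousWithinAt.comp (t := Ici (2 * y - 1)) (f := fun z => 2 * z - 1) (ih _)
          (by fun_prop) fun z hz => ?_
        have : y ≤ z := hz
        simpa using this
      refine h1.congr (fun z hz => ?_) ?_
      · have : y ≤ z := hz
        rw [approxCdf, if_neg (by linarith)]
      · rw [approxCdf, if_neg hy]

end Approx

/-- The pointwise limit of the functions `approxCdf x n`. -/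
noncomputable def limitCdf (x y : ℝ) : ℝ := ⨅ n, approxCdf x n y

section Limit

variable {x : ℝ} (hx0 : 0 < x) (hx1 : x ≤ 1)

lemma approxCdf_tendsto (hx0 : 0 < x) (hx1 : x ≤ 1) (y : ℝ) :
    Tendsto (fun n => approxCdf x n y) atTop (𝓝 (limitCdf x y)) :=
  tendsto_atTop_ciInf (approxCdf_antitone hx0 hx1 y)
    ⟨0, by rintro _ ⟨n, rfl⟩; exact (approxCdf_mem hx0 hx1 n y).1⟩

lemma limitCdf_le_approxCdf (hx0 : 0 < x) (hx1 : x ≤ 1) (n : ℕ) (y : ℝ) :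
    limitCdf x y ≤ approxCdf x n y :=
  (approxCdf_antitone hx0 hx1 y).le_of_tendsto (approxCdf_tendsto hx0 hx1 y) n

lemma limitCdf_mem (hx0 : 0 < x) (hx1 : x ≤ 1) (y : ℝ) : limitCdf x y ∈ Icc (0 : ℝ) 1 :=
  isClosed_Icc.mem_of_tendsto (approxCdf_tendsto hx0 hx1 y)
    (Eventually.of_forall fun n => approxCdf_mem hx0 hx1 n y)

lemma limitCdf_mono (hx0 : 0 < x) (hx1 : x ≤ 1) : Monotone (limitCdf x) := fun y z h =>
  le_of_tendsto_of_tendsto' (approxCdf_tendsto hx0 hx1 y) (approxCdf_tendsto hx0 hx1 z)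
    fun n => approxCdf_mono hx0 hx1 n h

lemma limitCdf_of_neg {y : ℝ} (hy : y < 0) : limitCdf x y = 0 := by
  simp [limitCdf, approxCdf_of_neg _ hy]

lemma limitCdf_of_one_le (hx0 : 0 < x) {y : ℝ} (hy : 1 ≤ y) : limitCdf x y = 1 := by
  simp [limitCdf, approxCdf_of_one_le hx0 _ hy]

lemma limitCdf_left (hx0 : 0 < x) (hx1 : x ≤ 1) {y : ℝ} (hy : y < 1 / 2) :
    limitCdf x y = leftBranch x (limitCdf x (2 * y)) := by
  refine tendsto_nhds_unique ((approxCdf_tendsto hx0 hx1 y).comp (tendsto_add_atTop_nat 1)) ?_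
  have h := (leftBranch_continuousAt hx0 (limitCdf_mem hx0 hx1 (2 * y))).tendsto.comp
    (approxCdf_tendsto hx0 hx1 (2 * y))
  refine h.congr fun n => ?_
  simp only [Function.comp_apply]
  rw [approxCdf, if_pos hy]

lemma limitCdf_right (hx0 : 0 < x) (hx1 : x ≤ 1) {y : ℝ} (hy : 1 / 2 ≤ y) :
    limitCdf x y = rightBranch x (limitCdf x (2 * y - 1)) := by
  refine tendsto_nhds_unique ((approxCdf_tendsto hx0 hx1 y).comp (tendsto_add_atTop_nat 1)) ?_
  have h := (rightBranch_continuousAt hx0 (limitCdf_mem hx0 hx1 (2 * y - 1))).tendsto.comp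
    (approxCdf_tendsto hx0 hx1 (2 * y - 1))
  refine h.congr fun n => ?_
  simp only [Function.comp_apply]
  rw [approxCdf, if_neg (not_lt.2 hy)]

/-- The value at `0` is fixed by the left branch, whose only nonzero fixed point is `2`. For `x = 1`
the branch is the identity and the claim fails. -/
lemma limitCdf_zero (hx0 : 0 < x) (hx1 : x < 1) : limitCdf x 0 = 0 := by
  have h := limitCdf_left hx0 hx1.le (y := 0) (by norm_num)
  have hm := limitCdf_mem hx0 hx1.le 0
  have hd := leftBranch_denom_pos hx0 hm
  rw [mul_zero, leftBranch, eq_div_iff hd.ne'] at h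
  by_contra h0
  have h2 : 1 - (1 - x) / 2 * limitCdf x 0 = x := by
    apply mul_left_cancel₀ h0; linarith
  nlinarith [hm.2]

lemma limitCdf_left' (hx0 : 0 < x) (hx1 : x < 1) {y : ℝ} (hy : y ≤ 1 / 2) :
    limitCdf x y = leftBranch x (limitCdf x (2 * y)) := by
  rcases hy.lt_or_eq with h | rfl
  · exact limitCdf_left hx0 hx1.le h
  · rw [limitCdf_right hx0 hx1.le le_rfl, limitCdf_of_one_le hx0 (y := 2 * (1 / 2)) (by norm_num),
      leftBranch_one_eq_rightBranch_zero]
    norm_num [limitCdf_zero hx0 hx1]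

/-- An infimum of right-continuous functions is upper semicontinuous from the right; monotonicity
supplies the other bound. -/
lemma limitCdf_rightContinuous (hx0 : 0 < x) (hx1 : x ≤ 1) (y : ℝ) : ContinuousWithinAt
    (limitCdf x) (Ici y) y := by
  refine tendsto_order.2 ⟨fun a ha => ?_, fun a ha => ?_⟩
  · filter_upwards [self_mem_nhdsWithin] with z hz
    exact ha.trans_le (limitCdf_mono hx0 hx1 hz)
  · obtain ⟨n, hn⟩ := ((tendsto_order.1 (approxCdf_tendsto hx0 hx1 y)).2 a ha).exists
    filter_upwards [(tendsto_order.1 (approxCdf_rightContinuous hx0 hx1 n y)).2 a hn] with z hz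
    exact (limitCdf_le_approxCdf hx0 hx1 n z).trans_lt hz

/-- `limitCdf x` as a Stieltjes function. -/
noncomputable def limitStieltjes (x : ℝ) (hx0 : 0 < x) (hx1 : x ≤ 1) : StieltjesFunction ℝ where
  toFun := limitCdf x
  mono' := limitCdf_mono hx0 hx1
  right_continuous' := limitCdf_rightContinuous hx0 hx1

lemma limitStieltjes_tendsto_atBot :
    Tendsto (limitStieltjes x hx0 hx1) atBot (𝓝 0) := by
  refine tendsto_const_nhds.congr' ?_
  filter_upwards [Iio_mem_atBot (0 : ℝ)] with y hy
  exact (limitCdf_of_neg hy).symm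

lemma limitStieltjes_tendsto_atTop :
    Tendsto (limitStieltjes x hx0 hx1) atTop (𝓝 1) := by
  refine tendsto_const_nhds.congr' ?_
  filter_upwards [Ici_mem_atTop (1 : ℝ)] with y hy
  exact (limitCdf_of_one_le hx0 hy).symm

/-- The limit law. -/
noncomputable def limitLaw (x : ℝ) (hx0 : 0 < x) (hx1 : x ≤ 1) : ProbabilityMeasure ℝ :=
  ⟨(limitStieltjes x hx0 hx1).measure,
    (limitStieltjes x hx0 hx1).isProbabilityMeasure (limitStieltjes_tendsto_atBot hx0 hx1)
      (limitStieltjes_tendsto_atTop hx0 hx1)⟩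

lemma cdf_limitLaw (y : ℝ) : cdf (limitLaw x hx0 hx1 : Measure ℝ) y = limitCdf x y := by
  have := cdf_measure_stieltjesFunction (limitStieltjes x hx0 hx1)
    (limitStieltjes_tendsto_atBot hx0 hx1) (limitStieltjes_tendsto_atTop hx0 hx1)
  exact congrArg (fun f : StieltjesFunction ℝ => f y) this

lemma limitLaw_Icc : (limitLaw x hx0 hx1 : Measure ℝ) (Icc 0 1) = 1 := by
  have h0 : Function.leftLim (limitStieltjes x hx0 hx1) 0 = 0 := by
    refine leftLim_eq_of_tendsto (tendsto_const_nhds.congr' ?_)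
    filter_upwards [self_mem_nhdsWithin] with y hy
    exact (limitCdf_of_neg hy).symm
  have h1 : limitStieltjes x hx0 hx1 1 = 1 := limitCdf_of_one_le hx0 le_rfl
  change (limitStieltjes x hx0 hx1).measure (Icc 0 1) = 1
  rw [StieltjesFunction.measure_Icc, h0, h1]
  simp

end Limit

/-! ### Absolute continuity at `x = 1 / 2` -/

lemma StieltjesFunction.measure_absolutelyContinuous_of_sub_le (f : StieltjesFunction ℝ)
    (K : NNReal) (hf : ∀ y z, y ≤ z → f z - f y ≤ K * (z - y)) : f.measure ≪ volume := by
  -- The Lipschitz bound makes `K y - f y` monotone, so its measure is the positive difference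
  -- between `K` times Lebesgue measure and the measure of `f`.
  let h : StieltjesFunction ℝ :=
    { toFun := fun y => K * y - f y
      mono' := fun y z hyz => by have := hf y z hyz; dsimp only; nlinarith
      right_continuous' := fun y => ContinuousWithinAt.sub (by fun_prop) (f.right_continuous y) }
  have e : f + h = K • StieltjesFunction.id := by
    ext y
    change f y + (K * y - f y) = K * y
    ring
  have e2 : f.measure + h.measure = K • volume := by
    rw [← StieltjesFunction.measure_add, e, StieltjesFunction.measure_smul,
      Real.volume_eq_stieltjes_id]
  have hle : f.measure ≤ K • volume := e2 ▸ Measure.le_add_right le_rfl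
  exact (Measure.absolutelyContinuous_of_le hle).trans Measure.smul_absolutelyContinuous

/-- For `x = 1/2` the function `s ↦ 2s / (1 + s)` solves the functional equation exactly. A shift of
its argument is halved by each application, so the initial error `1` becomes `2^{-n}`. -/
lemma approxCdf_half_bounds (n : ℕ) {y : ℝ} (hy : y ∈ Ico (0 : ℝ) 1) :
    2 * y / (1 + y) ≤ approxCdf (1 / 2) n y ∧
      approxCdf (1 / 2) n y ≤ 2 * (y + 1 / 2 ^ n) / (1 + (y + 1 / 2 ^ n)) := by
  have key0 : ∀ s : ℝ, 0 ≤ s →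
      leftBranch (1 / 2) (2 * s / (1 + s)) = 2 * (s / 2) / (1 + s / 2) := fun s hs => by
    have h1 : 1 + s ≠ 0 := by positivity
    have h2 : 1 + s / 2 ≠ 0 := by positivity
    have h3 : 2 + s ≠ 0 := by positivity
    have h4 : 1 - (1 - 1 / 2) / 2 * (2 * s / (1 + s)) = (2 + s) / (2 * (1 + s)) := by
      field_simp; ring
    rw [leftBranch, h4]
    field_simp
  have key1 : ∀ s : ℝ, 0 ≤ s →
      rightBranch (1 / 2) (2 * s / (1 + s)) = 2 * ((1 + s) / 2) / (1 + (1 + s) / 2) :=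
        fun s hs => by
    have h1 : 1 + s ≠ 0 := by positivity
    have h3 : 3 + s ≠ 0 := by positivity
    have h2 : 1 + (1 + s) / 2 ≠ 0 := by positivity
    have h4 : 1 - (1 - 1 / 2) / 2 * (1 + 2 * s / (1 + s)) = (3 + s) / (4 * (1 + s)) := by
      field_simp; ring
    rw [rightBranch, h4]
    field_simp
    ring
  -- The shifted argument can exceed `1`, so the branch maps are needed beyond `[0, 1]`; they remain
  -- increasing below `2`.
  have lt2 : ∀ s : ℝ, 0 ≤ s → 2 * s / (1 + s) < 2 := fun s hs => by
    rw [div_lt_iff₀ (by positivity)]; linarith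
  have mono0 : ∀ z w : ℝ, 0 ≤ w → z ≤ w → w < 2 →
      leftBranch (1 / 2) z ≤ leftBranch (1 / 2) w := fun z w h0 h h2 => by
    have : 0 < 1 - (1 - 1 / 2) / 2 * w := by linarith
    unfold leftBranch
    gcongr
  have mono1 : ∀ z w : ℝ, z ≤ w → w < 2 →
      rightBranch (1 / 2) z ≤ rightBranch (1 / 2) w := fun z w h h2 => by
    have : 0 < 1 - (1 - 1 / 2) / 2 * (1 + w) := by linarith
    unfold rightBranch
    gcongr
  have hmem := approxCdf_mem (x := 1 / 2) (by norm_num) (by norm_num)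
  induction n generalizing y with
  | zero =>
    have h1 : approxCdf (1 / 2) 0 y = 1 := by simp [approxCdf, hy.1]
    have h2 := hy.1
    rw [h1, div_le_one (by positivity), le_div_iff₀ (by positivity)]
    constructor
    · linarith [hy.2]
    · norm_num; linarith
  | succ n ih =>
    have hp : (0 : ℝ) < 1 / 2 ^ n := by positivity
    have h2 := hy.1
    rw [approxCdf]
    split_ifs with h
    · obtain ⟨l, r⟩ := ih (y := 2 * y) ⟨by linarith, by linarith⟩
      have hl := mono0 _ _ (hmem _ _).1 l ((hmem _ _).2.trans_lt one_lt_two)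
      have hr := mono0 _ _ (by positivity) r (lt2 _ (by positivity))
      rw [key0 _ (by positivity)] at hl hr
      refine ⟨by convert hl using 1; ring, by convert hr using 1; ring⟩
    · have h3 : 0 ≤ 2 * y - 1 := by linarith
      obtain ⟨l, r⟩ := ih (y := 2 * y - 1) ⟨h3, by linarith [hy.2]⟩
      have hl := mono1 _ _ l ((hmem _ _).2.trans_lt one_lt_two)
      have hr := mono1 _ _ r (lt2 _ (by positivity))
      rw [key1 _ (by positivity)] at hl hr
      refine ⟨by convert hl using 1; ring, by convert hr using 1; ring⟩

lemma limitCdf_half {y : ℝ} (hy : y ∈ Icc (0 : ℝ) 1) : limitCdf (1 / 2) y = 2 * y / (1 + y) := by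
  rcases hy.2.lt_or_eq with h1 | rfl
  · refine tendsto_nhds_unique (approxCdf_tendsto (by norm_num) (by norm_num) y) ?_
    have h0 : Tendsto (fun n : ℕ => y + 1 / (2 : ℝ) ^ n) atTop (𝓝 y) := by
      have := (tendsto_pow_atTop_nhds_zero_of_lt_one (r := (1 / 2 : ℝ)) (by norm_num)
        (by norm_num)).const_add y
      simpa using this
    have hd : 1 + y ≠ 0 := by have := hy.1; positivity
    refine tendsto_of_tendsto_of_tendsto_of_le_of_le tendsto_const_nhds
      ((h0.const_mul 2).div (h0.const_add 1) hd)
      (fun n => (approxCdf_half_bounds n ⟨hy.1, h1⟩).1)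
      (fun n => (approxCdf_half_bounds n ⟨hy.1, h1⟩).2)
  · rw [limitCdf_of_one_le (by norm_num) le_rfl]; norm_num

lemma limitCdf_half_sub_le {y z : ℝ} (h : y ≤ z) :
    limitCdf (1 / 2) z - limitCdf (1 / 2) y ≤ 2 * (z - y) := by
  have main : ∀ {y z : ℝ}, 0 ≤ y → y ≤ z → z ≤ 1 →
      limitCdf (1 / 2) z - limitCdf (1 / 2) y ≤ 2 * (z - y) := by
    intro y z hy h hz
    have hz0 := hy.trans h
    rw [limitCdf_half ⟨hy, h.trans hz⟩, limitCdf_half ⟨hz0, hz⟩,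
      div_sub_div _ _ (by positivity) (by positivity), div_le_iff₀ (by positivity)]
    nlinarith [mul_nonneg hy hz0, mul_nonneg (sub_nonneg.2 h) hy,
      mul_nonneg (sub_nonneg.2 h) hz0, mul_nonneg (sub_nonneg.2 h) (mul_nonneg hy hz0)]
  have e0 : limitCdf (1 / 2) 0 = 0 := limitCdf_zero (by norm_num) (by norm_num)
  have e1 : limitCdf (1 / 2) 1 = 1 := limitCdf_of_one_le (by norm_num) le_rfl
  have ge1 : ∀ {y : ℝ}, 1 ≤ y → limitCdf (1 / 2) y = 1 := limitCdf_of_one_le (by norm_num)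
  rcases lt_or_ge z 0 with hz0 | hz0
  · rw [limitCdf_of_neg hz0, limitCdf_of_neg (h.trans_lt hz0)]; linarith
  rcases lt_or_ge y 0 with hy0 | hy0
  · rw [limitCdf_of_neg hy0]
    rcases le_total z 1 with hz1 | hz1
    · have := main le_rfl hz0 hz1
      linarith
    · have := main le_rfl zero_le_one le_rfl
      rw [ge1 hz1]; linarith
  · rcases le_total z 1 with hz1 | hz1
    · exact main hy0 h hz1
    · rcases le_total y 1 with hy1 | hy1
      · have := main hy0 hy1 le_rfl
        rw [ge1 hz1]; linarith
      · rw [ge1 hz1, ge1 hy1]; linarith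

lemma MeasureTheory.Measure.AbsolutelyContinuous.restrict_of_measure_compl_eq_zero {α : Type*}
    [MeasurableSpace α] {μ ν : Measure α} (h : μ ≪ ν) {s : Set α} (hs : MeasurableSet s)
    (h0 : μ sᶜ = 0) : μ ≪ ν.restrict s := by
  intro t ht
  rw [Measure.restrict_apply₀' hs.nullMeasurableSet] at ht
  refine measure_mono_null (t := (t ∩ s) ∪ sᶜ) (fun y hy => ?_) (measure_union_null (h ht) h0)
  by_cases hys : y ∈ s
  · exact Or.inl ⟨hy, hys⟩
  · exact Or.inr hys

lemma limitLaw_half_absolutelyContinuous {x : ℝ} (hx0 : 0 < x) (hx1 : x ≤ 1) (hx : x = 1 / 2) :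
    (limitLaw x hx0 hx1 : Measure ℝ) ≪ volume.restrict (Icc 0 1) := by
  refine Measure.AbsolutelyContinuous.restrict_of_measure_compl_eq_zero ?_ measurableSet_Icc
    ((prob_compl_eq_zero_iff measurableSet_Icc).2 (limitLaw_Icc hx0 hx1))
  subst hx
  exact StieltjesFunction.measure_absolutelyContinuous_of_sub_le _ 2
    fun y z h => limitCdf_half_sub_le h

/-- For `x = 1` the left branch is the identity, so the full mass stays at the point `0`. -/
lemma limitLaw_one_mutuallySingular {x : ℝ} (hx0 : 0 < x) (hx1 : x ≤ 1) (hx : x = 1) :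
    (limitLaw x hx0 hx1 : Measure ℝ) ⟂ₘ volume.restrict (Icc 0 1) := by
  subst hx
  refine ⟨Ioi 0, measurableSet_Ioi, ?_, ?_⟩
  · have h0 : limitCdf 1 0 = 1 := by
      have : ∀ n, approxCdf 1 n 0 = 1 := fun n => by
        induction n with
        | zero => simp [approxCdf]
        | succ n ih => norm_num [approxCdf, ih, leftBranch]
      simp [limitCdf, this]
    have h1 := ofReal_cdf (limitLaw 1 hx0 hx1 : Measure ℝ) 0
    rw [cdf_limitLaw, h0, ENNReal.ofReal_one] at h1
    rw [← compl_Iic, prob_compl_eq_zero_iff measurableSet_Iic, h1]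
  · rw [compl_Ioi, Measure.restrict_apply measurableSet_Iic]
    refine measure_mono_null (t := {0}) (fun y hy => ?_) (by simp)
    exact le_antisymm hy.1 hy.2.1

/-! ### Singularity for `x ≠ 1 / 2` -/

/-- Each endpoint contributes an error of at most `ε / 2` times its distance to `t`, and these
distances add up to the length of the interval. -/
lemma HasDerivAt.tendsto_slope_straddle {f : ℝ → ℝ} {d t : ℝ} (hf : HasDerivAt f d t)
    {l h : ℕ → ℝ} (hh : ∀ n, 0 < h n) (hl : ∀ n, l n ≤ t) (hr : ∀ n, t ≤ l n + h n)
    (h0 : Tendsto h atTop (𝓝 0)) :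
    Tendsto (fun n => (f (l n + h n) - f (l n)) / h n) atTop (𝓝 d) := by
  have hlt : Tendsto l atTop (𝓝 t) := by
    have h1 : Tendsto (fun n => t - h n) atTop (𝓝 t) := by simpa using h0.const_sub t
    exact tendsto_of_tendsto_of_tendsto_of_le_of_le h1 tendsto_const_nhds
      (fun n => by dsimp only; linarith [hr n]) hl
  have hrt : Tendsto (fun n => l n + h n) atTop (𝓝 t) := by simpa using hlt.add h0
  rw [Metric.tendsto_atTop]
  intro ε hε
  have ho := (hasDerivAt_iff_isLittleO.1 hf).def (half_pos hε)
  obtain ⟨N, hN⟩ := eventually_atTop.1 ((hlt.eventually ho).and (hrt.eventually ho))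
  refine ⟨N, fun n hn => ?_⟩
  obtain ⟨h1, h2⟩ := hN n hn
  simp only [Real.norm_eq_abs, smul_eq_mul] at h1 h2
  rw [abs_of_nonpos (by linarith [hl n] : l n - t ≤ 0)] at h1
  rw [abs_of_nonneg (by linarith [hr n] : 0 ≤ l n + h n - t)] at h2
  have hp := hh n
  rw [Real.dist_eq, show (f (l n + h n) - f (l n)) / h n - d =
    ((f (l n + h n) - f (l n)) - d * h n) / h n by field_simp, abs_div, abs_of_pos hp,
    div_lt_iff₀ hp, abs_lt]
  rw [abs_le] at h1 h2
  have : 0 < ε * h n := by positivity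
  constructor <;> nlinarith [hl n, hr n]

/-- If `θ` stayed in `[1/2, 1)` from some time on, its distance to `1` would double forever. -/
lemma frequently_lt_half_of_doubling {θ : ℕ → ℝ} (h1 : ∀ n, θ n < 1)
    (h0 : ∀ n, 0 ≤ θ n) (h : ∀ n, 1 / 2 ≤ θ n → θ (n + 1) = 2 * θ n - 1) :
    ∃ᶠ n in atTop, θ n < 1 / 2 := by
  rw [frequently_atTop]
  by_contra! hc
  obtain ⟨N, hN⟩ := hc
  have key : ∀ k, 1 - θ (N + k) = 2 ^ k * (1 - θ N) := fun k => by
    induction k with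
    | zero => simp
    | succ k ih =>
      rw [← add_assoc, h _ (hN _ (by omega)), pow_succ, mul_right_comm, ← ih]
      ring
  have hp : 0 < 1 - θ N := by linarith [h1 N]
  obtain ⟨k, hk⟩ := pow_unbounded_of_one_lt (1 / (1 - θ N)) (one_lt_two (α := ℝ))
  rw [div_lt_iff₀ hp, ← key] at hk
  linarith [h0 (N + k)]

/-- A dyadic interval around a point of `[0, 1)`, together with a description of the limit
distribution function on it: on `[left, left + 2^{-n}]` it is the image of the whole function
under `z ↦ f left + scale * z / (1 + slope * z)`, and the point is `left + 2^{-n} * frac`. -/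
structure DyadicState where
  left : ℝ
  frac : ℝ
  slope : ℝ
  scale : ℝ

/-- Passing to the half of the `n`-th dyadic interval that contains the point. -/
noncomputable def DyadicState.next (x : ℝ) (n : ℕ) (s : DyadicState) : DyadicState :=
  if s.frac < 1 / 2 then
    ⟨s.left, 2 * s.frac, x * s.slope - (1 - x) / 2, s.scale * x⟩
  else
    ⟨s.left + 1 / 2 ^ (n + 1), 2 * s.frac - 1,
      -((1 - x) / 2) / (1 - (1 - x) / 2 + x * s.slope),
      s.scale * x * ((1 - x) / 2) / (1 - (1 - x) / 2 + x * s.slope) ^ 2⟩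

/-- The state at level `n` of the point `t`. -/
noncomputable def dyadicState (x t : ℝ) : ℕ → DyadicState
  | 0 => ⟨0, t, 0, 1⟩
  | n + 1 => (dyadicState x t n).next x n

/-- The properties maintained by `DyadicState.next`. -/
structure DyadicState.Valid (x t : ℝ) (n : ℕ) (s : DyadicState) : Prop where
  point : t = s.left + s.frac / 2 ^ n
  frac_nonneg : 0 ≤ s.frac
  frac_lt : s.frac < 1
  slope_gt : -1 < s.slope
  slope_le : s.slope ≤ 0
  scale_pos : 0 < s.scale
  eq : ∀ y ∈ Icc (0 : ℝ) 1, limitCdf x (s.left + y / 2 ^ n) =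
    limitCdf x s.left + s.scale * limitCdf x y / (1 + s.slope * limitCdf x y)

section Singular

variable {x : ℝ}

/-- The maps `z ↦ D z / (1 + ρ z)` are the Möbius maps fixing `0`; the left branch fixes `0` too, so
composition only changes `ρ` and `D`. The right branch moves `0`, so there the value at `0` must be
subtracted to return to this form. -/
lemma scale_mul_leftBranch {ρ D z : ℝ} (h1 : 1 - (1 - x) / 2 * z ≠ 0) :
    D * leftBranch x z / (1 + ρ * leftBranch x z) =
      D * x * z / (1 + (x * ρ - (1 - x) / 2) * z) := by
  have d3 : 1 + ρ * leftBranch x z =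
      (1 + (x * ρ - (1 - x) / 2) * z) / (1 - (1 - x) / 2 * z) := by
    rw [leftBranch, eq_div_iff h1, add_mul, mul_assoc, div_mul_cancel₀ _ h1]; ring
  rw [d3, leftBranch, mul_div_assoc', div_div_div_cancel_right₀ h1, mul_assoc]

lemma scale_mul_rightBranch {ρ D z : ℝ} (h1 : 1 - (1 - x) / 2 * (1 + z) ≠ 0) :
    D * rightBranch x z / (1 + ρ * rightBranch x z) =
      D * x / (1 - (1 - x) / 2 + x * ρ - (1 - x) / 2 * z) := by
  have d3 : 1 + ρ * rightBranch x z =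
      (1 - (1 - x) / 2 + x * ρ - (1 - x) / 2 * z) / (1 - (1 - x) / 2 * (1 + z)) := by
    rw [rightBranch, eq_div_iff h1, add_mul, mul_assoc, div_mul_cancel₀ _ h1]; ring
  rw [d3, rightBranch, mul_div_assoc', div_div_div_cancel_right₀ h1]

lemma DyadicState.Valid.next (hx0 : 0 < x) (hx1 : x < 1) {t : ℝ} {n : ℕ} {s : DyadicState}
    (h : s.Valid x t n) :
    (s.next x n).Valid x t (n + 1) := by
  have hA : 0 < (1 - x) / 2 := by linarith
  -- Equivalent to `x (1 + slope) > 0`; it keeps the new slope above `-1` on the right half.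
  have hG1 : (1 - x) / 2 < 1 - (1 - x) / 2 + x * s.slope := by nlinarith [h.slope_gt]
  have hG : 0 < 1 - (1 - x) / 2 + x * s.slope := hA.trans hG1
  have hmem := limitCdf_mem hx0 hx1.le
  unfold DyadicState.next
  split_ifs with hf
  · refine ⟨?_, ?_, ?_, ?_, ?_, ?_, fun y hy => ?_⟩
    · rw [h.point, pow_succ]; field_simp
    · have := h.frac_nonneg; simp only; positivity
    · simp only; linarith
    · simp only; nlinarith [h.slope_gt]
    · simp only; nlinarith [h.slope_le]
    · exact mul_pos h.scale_pos hx0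
    · have e := h.eq (y / 2) ⟨by linarith [hy.1], by linarith [hy.2]⟩
      have e2 : s.left + y / 2 ^ (n + 1) = s.left + y / 2 / 2 ^ n := by rw [pow_succ]; field_simp
      rw [e2, e, limitCdf_left' hx0 hx1 (y := y / 2) (by linarith [hy.2]),
        mul_div_cancel₀ _ two_ne_zero,
        scale_mul_leftBranch (leftBranch_denom_pos hx0 (hmem y)).ne']
  · refine ⟨?_, ?_, ?_, ?_, ?_, ?_, fun y hy => ?_⟩
    · rw [h.point, pow_succ]; field_simp; ring
    · simp only; linarith
    · have := h.frac_lt; simp only; linarith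
    · rw [neg_div, neg_lt_neg_iff, div_lt_one hG]; exact hG1
    · rw [neg_div, neg_nonpos]; positivity
    · have := h.scale_pos; positivity
    · have e := h.eq ((1 + y) / 2) ⟨by linarith [hy.1], by linarith [hy.2]⟩
      have e' := h.eq (1 / 2) ⟨by norm_num, by norm_num⟩
      have e2 : s.left + 1 / 2 ^ (n + 1) + y / 2 ^ (n + 1) = s.left + (1 + y) / 2 / 2 ^ n := by
        rw [pow_succ]; field_simp; ring
      have e3 : s.left + 1 / 2 ^ (n + 1) = s.left + 1 / 2 / 2 ^ n := by
        rw [pow_succ]; field_simp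
      have hz := hmem y
      have d2 : 0 < 1 - (1 - x) / 2 + x * s.slope - (1 - x) / 2 * limitCdf x y := by
        nlinarith [hz.1, hz.2]
      rw [limitCdf_right hx0 hx1.le (y := (1 + y) / 2) (by linarith [hy.1]),
        show 2 * ((1 + y) / 2) - 1 = y by ring,
        scale_mul_rightBranch (rightBranch_denom_pos hx0 hz).ne'] at e
      rw [limitCdf_right hx0 hx1.le (y := 1 / 2) le_rfl, show (2 : ℝ) * (1 / 2) - 1 = 0 by norm_num,
        limitCdf_zero hx0 hx1, scale_mul_rightBranch (rightBranch_denom_pos hx0 (by simp)).ne',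
        mul_zero, sub_zero] at e'
      simp only
      rw [e2, e, e3, e', add_assoc]
      -- With `a = (1 - x) / 2`, `g = 1 - a + x * slope` and `D` the old scale, what remains is `D x
      -- / (g - a z) = D x / g + (D x a / g²) z / (1 - (a / g) z)`.
      congr 1
      generalize limitCdf x y = z at *
      generalize (1 - x) / 2 = a at *
      generalize 1 - a + x * s.slope = g at *
      have d3 : 1 + -a / g * z = (g - a * z) / g := by field_simp; ring
      rw [d3]
      field_simp
      ring

lemma DyadicState.valid (hx0 : 0 < x) (hx1 : x < 1) {t : ℝ} (ht : t ∈ Ico (0 : ℝ) 1) (n : ℕ) :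
    (dyadicState x t n).Valid x t n := by
  induction n with
  | zero =>
    refine ⟨?_, ht.1, ht.2, ?_, ?_, ?_, fun y hy => ?_⟩ <;>
      simp [dyadicState, limitCdf_zero hx0 hx1]
  | succ n ih => exact ih.next hx0 hx1

/-- A nonzero derivative forces the ratio of consecutive difference quotients along the dyadic
intervals around `t` to tend to `1`, which pins down the limit of the slopes in two incompatible
ways. -/
lemma limitCdf_deriv_eq_zero (hx0 : 0 < x) (hx1 : x < 1) (hx : x ≠ 1 / 2) {t d : ℝ}
    (ht : t ∈ Ico (0 : ℝ) 1)
    (hd : HasDerivAt (limitCdf x) d t) : d = 0 := by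
  by_contra hd0
  let S := dyadicState x t
  have V : ∀ n, (S n).Valid x t n := DyadicState.valid hx0 hx1 ht
  have hc1 : leftBranch x 1 = 2 * x / (1 + x) := by
    rw [leftBranch, show 1 - (1 - x) / 2 * 1 = (1 + x) / 2 by ring]; field_simp
  set c := 2 * x / (1 + x) with hc
  have hc0 : 0 < c := by positivity
  have hclt : c < 1 := by rw [hc, div_lt_one (by positivity)]; linarith
  have hnext : ∀ n, S (n + 1) = (S n).next x n := fun n => rfl
  have f1 : limitCdf x 1 = 1 := limitCdf_of_one_le hx0 le_rfl
  have fhalf : limitCdf x (1 / 2) = c := by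
    rw [limitCdf_left' hx0 hx1 le_rfl, mul_div_cancel₀ _ two_ne_zero, f1, hc1]
  set q : ℕ → ℝ := fun n =>
    (limitCdf x ((S n).left + 1 / 2 ^ n) - limitCdf x (S n).left) / (1 / 2 ^ n) with hq
  have hqd : Tendsto q atTop (𝓝 d) := by
    refine hd.tendsto_slope_straddle (fun n => by positivity) (fun n => ?_) (fun n => ?_) ?_
    · have := (V n).point
      have : 0 ≤ (S n).frac / 2 ^ n := by have := (V n).frac_nonneg; positivity
      linarith [(V n).point]
    · have : (S n).frac / 2 ^ n ≤ 1 / 2 ^ n := by have := (V n).frac_lt; gcongr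
      linarith [(V n).point]
    · have := tendsto_pow_atTop_nhds_zero_of_lt_one (r := (1 / 2 : ℝ)) (by norm_num) (by norm_num)
      simpa using this
  have hqn : ∀ n, q n = 2 ^ n * ((S n).scale / (1 + (S n).slope)) := fun n => by
    simp only [hq]
    rw [(V n).eq 1 (by simp), f1]
    field_simp
    ring
  have hden : ∀ n, 0 < 1 + (S n).slope * c := fun n => by
    nlinarith [(V n).slope_gt, (V n).slope_le]
  have hmid : ∀ n, limitCdf x ((S n).left + 1 / 2 ^ (n + 1)) =
      limitCdf x (S n).left + (S n).scale * c / (1 + (S n).slope * c) := fun n => by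
    have := (V n).eq (1 / 2) (by norm_num)
    rw [fhalf] at this
    rw [← this, pow_succ]
    congr 2
    field_simp
  -- Here `r n / 2` is the share of the mass of the `n`-th interval carried by its left half; the
  -- factor `2` accounts for the halved length.
  set r : ℕ → ℝ := fun n => 2 * (c * (1 + (S n).slope) / (1 + (S n).slope * c)) with hr
  have hqpos : ∀ n, 0 < q n := fun n => by
    rw [hqn]
    have := (V n).scale_pos
    have := (V n).slope_gt
    have : 0 < 1 + (S n).slope := by linarith
    positivity
  have hleft : ∀ n, (S n).frac < 1 / 2 → q (n + 1) = r n * q n := fun n hn => by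
    have h1 : 0 < 1 + (S n).slope := by linarith [(V n).slope_gt]
    have h2 := (hden n).ne'
    have e : (S (n + 1)).left = (S n).left := by rw [hnext, DyadicState.next, if_pos hn]
    rw [hqn n, hr]
    simp only [hq]
    rw [e, hmid, pow_succ]
    field_simp
    ring
  have hright : ∀ n, ¬ (S n).frac < 1 / 2 → q (n + 1) = (2 - r n) * q n := fun n hn => by
    have h1 : 0 < 1 + (S n).slope := by linarith [(V n).slope_gt]
    have h2 := (hden n).ne'
    have e : (S (n + 1)).left = (S n).left + 1 / 2 ^ (n + 1) := by
      rw [hnext, DyadicState.next, if_neg hn]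
    have e2 : (S n).left + 1 / 2 ^ (n + 1) + 1 / 2 ^ (n + 1) = (S n).left + 1 / 2 ^ n := by
      rw [pow_succ]; field_simp; ring
    have e3 := (V n).eq 1 (by simp)
    rw [f1] at e3
    rw [hqn n, hr]
    simp only [hq]
    rw [e, e2, hmid, e3, pow_succ]
    field_simp
    ring
  have hratio : Tendsto (fun n => q (n + 1) / q n) atTop (𝓝 1) := by
    have := (hqd.comp (tendsto_add_atTop_nat 1)).div hqd hd0
    rwa [div_self hd0] at this
  have hr1 : Tendsto r atTop (𝓝 1) := by
    rw [tendsto_iff_dist_tendsto_zero] at hratio ⊢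
    refine hratio.congr fun n => ?_
    rw [Real.dist_eq, Real.dist_eq]
    by_cases hn : (S n).frac < 1 / 2
    · rw [hleft n hn, mul_div_cancel_right₀ _ (hqpos n).ne']
    · rw [hright n hn, mul_div_cancel_right₀ _ (hqpos n).ne', ← abs_neg]
      congr 1; ring
  -- The share is a Möbius function of the slope; inverting it turns convergence of shares to `1/2`
  -- into convergence of slopes.
  have hslope : Tendsto (fun n => (S n).slope) atTop (𝓝 ((1 / 2 - c) / (c * (1 - 1 / 2)))) := by
    have h2 : Tendsto (fun n => r n / 2) atTop (𝓝 (1 / 2)) := hr1.div_const 2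
    have h3 := (h2.sub_const c).div ((h2.const_sub 1).const_mul c) (by positivity)
    refine h3.congr fun n => ?_
    have h4 := (hden n).ne'
    have h8 : r n / 2 = c * (1 + (S n).slope) / (1 + (S n).slope * c) :=
      mul_div_cancel_left₀ _ two_ne_zero
    have h5 : 1 - r n / 2 = (1 - c) / (1 + (S n).slope * c) := by
      rw [h8, eq_div_iff h4, sub_mul, div_mul_cancel₀ _ h4]; ring
    have h6 : r n / 2 - c = (S n).slope * (c * (1 - c)) / (1 + (S n).slope * c) := by
      rw [h8, eq_div_iff h4, sub_mul, div_mul_cancel₀ _ h4]; ring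
    have h7 : 1 - c ≠ 0 := by linarith
    simp only [Pi.div_apply]
    rw [h5, h6]
    field_simp
  set L := (1 / 2 - c) / (c * (1 - 1 / 2)) with hL
  have hfreq : ∃ᶠ n in atTop, (S (n + 1)).slope - (x * (S n).slope - (1 - x) / 2) = 0 := by
    refine (frequently_lt_half_of_doubling (θ := fun n => (S n).frac) (fun n => (V n).frac_lt)
      (fun n => (V n).frac_nonneg) (fun n hn => ?_)).mono fun n hn => ?_
    · rw [hnext, DyadicState.next, if_neg (not_lt.2 hn)]
    · rw [hnext, DyadicState.next, if_pos hn, sub_self]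
  have hlim : Tendsto (fun n => (S (n + 1)).slope - (x * (S n).slope - (1 - x) / 2)) atTop
      (𝓝 (L - (x * L - (1 - x) / 2))) :=
    (hslope.comp (tendsto_add_atTop_nat 1)).sub ((hslope.const_mul x).sub_const _)
  -- A convergent sequence that vanishes infinitely often has limit `0`, so `L` is the fixed point
  -- of the left move.
  have hLeq : L - (x * L - (1 - x) / 2) = 0 := by
    by_contra hne
    exact hfreq ((hlim.eventually_ne hne).mono fun n hn h => hn h)
  have hL2 : L = -1 / 2 := by
    have : (1 - x) * (L + 1 / 2) = 0 := by linarith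
    rcases mul_eq_zero.1 this with h | h <;> linarith
  rw [hL, div_eq_iff (by positivity)] at hL2
  have hc23 : c = 2 / 3 := by linarith
  rw [hc, div_eq_iff (by positivity)] at hc23
  exact hx (by linarith)

/-- The density of the absolutely continuous part is almost everywhere the derivative of the
distribution function, which vanishes on `[0, 1)` by the previous lemma and off `[0, 1]` by
constancy. -/
lemma limitLaw_mutuallySingular (hx0 : 0 < x) (hx1 : x < 1) (hx : x ≠ 1 / 2) :
    (limitLaw x hx0 hx1.le : Measure ℝ) ⟂ₘ volume.restrict (Icc 0 1) := by
  suffices h : (limitLaw x hx0 hx1.le : Measure ℝ) ⟂ₘ volume from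
    h.mono_ac .rfl Measure.absolutelyContinuous_restrict
  change (limitStieltjes x hx0 hx1.le).measure ⟂ₘ volume
  rw [← Measure.rnDeriv_eq_zero]
  filter_upwards [(limitStieltjes x hx0 hx1.le).ae_hasDerivAt,
    Measure.rnDeriv_lt_top (limitStieltjes x hx0 hx1.le).measure volume,
    Measure.ae_ne volume (1 : ℝ)] with t ht hfin ht1
  have key : ((limitStieltjes x hx0 hx1.le).measure.rnDeriv volume t).toReal = 0 := by
    rcases lt_or_ge t 0 with h | h
    · refine ht.unique ((hasDerivAt_const t (0 : ℝ)).congr_of_eventuallyEq ?_)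
      filter_upwards [Iio_mem_nhds h] with y hy
      exact limitCdf_of_neg hy
    rcases lt_or_ge t 1 with h1 | h1
    · exact limitCdf_deriv_eq_zero hx0 hx1 hx ⟨h, h1⟩ ht
    · refine ht.unique ((hasDerivAt_const t (1 : ℝ)).congr_of_eventuallyEq ?_)
      filter_upwards [Ioi_mem_nhds (h1.lt_of_ne' ht1)] with y hy
      exact limitCdf_of_one_le hx0 hy.le
  exact (ENNReal.toReal_eq_zero_iff _).1 key |>.resolve_right hfin.ne

end Singular

/-! ### The parameter `x_u` -/

lemma xParam_pos (u : ℝ) : 0 < xParam u := by unfold xParam; positivity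

/-- Read as `2 u² x² + x = 1`, this is the normalization: excursions of either sign and the final
passage exhaust the possibilities. -/
lemma xParam_quadratic (u : ℝ) : u ^ 2 * xParam u ^ 2 = (1 - xParam u) / 2 := by
  have h := Real.sq_sqrt (show 0 ≤ 1 + 8 * u ^ 2 by positivity)
  have h0 := Real.sqrt_nonneg (1 + 8 * u ^ 2)
  unfold xParam
  generalize Real.sqrt (1 + 8 * u ^ 2) = s at *
  have h1 : 1 + s ≠ 0 := by positivity
  have h2 : u ^ 2 = (s ^ 2 - 1) / 8 := by linarith
  rw [h2]
  field_simp
  ring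

lemma xParam_le_one (u : ℝ) : xParam u ≤ 1 := by
  have := xParam_quadratic u
  have : 0 ≤ u ^ 2 * xParam u ^ 2 := by positivity
  linarith

lemma xParam_lt_one {u : ℝ} (hu : u ≠ 0) : xParam u < 1 := by
  have := xParam_quadratic u
  have := xParam_pos u
  have : 0 < u ^ 2 * xParam u ^ 2 := by positivity
  linarith

lemma xParam_zero : xParam 0 = 1 := by
  have := xParam_quadratic 0
  linarith

lemma xParam_one : xParam 1 = 1 / 2 := by
  have h := xParam_quadratic 1
  have h0 := xParam_pos 1
  have : (xParam 1 - 1 / 2) * (xParam 1 + 1) = 0 := by linarith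
  rcases mul_eq_zero.1 this with h | h <;> linarith

lemma eq_one_of_xParam_eq_half {u : ℝ} (hu : 0 ≤ u) (h : xParam u = 1 / 2) : u = 1 := by
  have h1 := xParam_quadratic u
  rw [h] at h1
  have : (u - 1) * (u + 1) = 0 := by linarith
  rcases mul_eq_zero.1 this with h | h <;> linarith

lemma moebiusDenom_deRhamMatrix0 (u z : ℝ) :
    moebiusDenom (deRhamMatrix0 u) z = 1 - (1 - xParam u) / 2 * z := by
  simp [moebiusDenom, deRhamMatrix0, xParam_quadratic]; ring

lemma moebiusDenom_deRhamMatrix1 (u z : ℝ) :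
    moebiusDenom (deRhamMatrix1 u) z = 1 - (1 - xParam u) / 2 * (1 + z) := by
  simp [moebiusDenom, deRhamMatrix1, xParam_quadratic]; ring

lemma moebius_deRhamMatrix0 (u z : ℝ) :
    moebius (deRhamMatrix0 u) z = leftBranch (xParam u) z := by
  rw [moebius, moebiusDenom_deRhamMatrix0, leftBranch]
  simp [deRhamMatrix0]

lemma moebius_deRhamMatrix1 (u z : ℝ) :
    moebius (deRhamMatrix1 u) z = rightBranch (xParam u) z := by
  rw [moebius, moebiusDenom_deRhamMatrix1, rightBranch]
  simp [deRhamMatrix1]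

lemma satisfiesDeRham_limitCdf {u : ℝ} (hu : 0 < u) : SatisfiesDeRham u (limitCdf (xParam u)) := by
  have h0 := xParam_pos u
  have h1 := xParam_lt_one hu.ne'
  refine ⟨fun y hy => ?_, fun y hy => ?_⟩
  · rw [moebiusDenom_deRhamMatrix0, moebius_deRhamMatrix0]
    exact ⟨(leftBranch_denom_pos h0 (limitCdf_mem h0 h1.le _)).ne', limitCdf_left' h0 h1 hy.2⟩
  · rw [moebiusDenom_deRhamMatrix1, moebius_deRhamMatrix1]
    exact ⟨(rightBranch_denom_pos h0 (limitCdf_mem h0 h1.le _)).ne',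
      limitCdf_right h0 h1.le hy.1⟩

/-- Pointwise convergence of the distribution functions implies weak convergence. -/
lemma tendsto_probabilityMeasure_of_tendsto_cdf {ι : Type*} {l : Filter ι}
    [l.IsCountablyGenerated] {μs : ι → ProbabilityMeasure ℝ} {μ : ProbabilityMeasure ℝ}
    (h : ∀ y, Tendsto (fun i => cdf (μs i : Measure ℝ) y) l (𝓝 (cdf (μ : Measure ℝ) y))) :
    Tendsto μs l (𝓝 μ) := by
  have hIoc : ∀ (ν : ProbabilityMeasure ℝ) (a b : ℝ), a ≤ b →
      ν (Ioc a b) = (cdf (ν : Measure ℝ) b - cdf (ν : Measure ℝ) a).toNNReal := by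
    intro ν a b hab
    have : (ν : Measure ℝ) (Ioc a b) =
        ENNReal.ofReal (cdf (ν : Measure ℝ) b - cdf (ν : Measure ℝ) a) := by
      conv_lhs => rw [← measure_cdf (ν : Measure ℝ)]
      exact StieltjesFunction.measure_Ioc _ _ _
    change ((ν : Measure ℝ) (Ioc a b)).toNNReal = _
    rw [this]; rfl
  refine (isPiSystem_Ioc (id : ℝ → ℝ) (id : ℝ → ℝ)).tendsto_probabilityMeasure_of_tendsto_of_mem
    ?_ ?_ ?_
  · rintro _ ⟨a, b, -, rfl⟩
    exact measurableSet_Ioc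
  · intro s hs y hy
    obtain ⟨ε, hε, hsub⟩ := Metric.isOpen_iff.1 hs y hy
    refine ⟨Ioc (y - ε / 2) (y + ε / 2), ⟨_, _, by simp only [id]; linarith, rfl⟩,
      Ioc_mem_nhds (by linarith) (by linarith), fun z hz => hsub ?_⟩
    rw [Metric.mem_ball, Real.dist_eq, abs_lt]
    constructor <;> linarith [hz.1, hz.2]
  · rintro _ ⟨a, b, hab, rfl⟩
    simp only [id] at hab ⊢
    simp_rw [hIoc _ _ _ hab.le]
    exact (continuous_real_toNNReal.tendsto _).comp ((h b).sub (h a))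

/-! ### Step lists -/

/-- The list of steps of a path, multiplied by a sign. -/
def signed (e : ℤˣ) (l : List ℤ) : List ℤ := l.map fun s => (e : ℤ) * s

@[simp] lemma signed_length (e : ℤˣ) (l : List ℤ) : (signed e l).length = l.length := by
  simp [signed]

@[simp] lemma signed_one (l : List ℤ) : signed 1 l = l := by simp [signed]

@[simp] lemma signed_nil (e : ℤˣ) : signed e [] = [] := rfl

@[simp] lemma signed_append (e : ℤˣ) (l r : List ℤ) :
    signed e (l ++ r) = signed e l ++ signed e r := by simp [signed]

@[simp] lemma signed_signed (e f : ℤˣ) (l : List ℤ) : signed e (signed f l) = signed (e * f) l := by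
  simp [signed, mul_assoc]

lemma signed_self (e : ℤˣ) (l : List ℤ) : signed e (signed e l) = l := by
  simp [Int.units_mul_self]

@[simp] lemma signed_sum (e : ℤˣ) (l : List ℤ) : (signed e l).sum = e * l.sum := by
  simpa [signed] using List.sum_map_mul_left l id (e : ℤ)

@[simp] lemma signed_take (e : ℤˣ) (l : List ℤ) (i : ℕ) :
    (signed e l).take i = signed e (l.take i) := by simp [signed, List.map_take]

lemma abs_unit_mul (e : ℤˣ) (z : ℤ) : |(e : ℤ) * z| = |z| := by
  rcases Int.units_eq_one_or e with rfl | rfl <;> simp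

/-- All steps of the list are `±1`. -/
def IsSteps (l : List ℤ) : Prop := ∀ s ∈ l, |s| = 1

lemma isSteps_signed {l : List ℤ} (h : IsSteps l) (e : ℤˣ) : IsSteps (signed e l) := by
  intro s hs
  obtain ⟨z, hz, rfl⟩ := List.mem_map.1 hs
  rw [abs_unit_mul]
  exact h z hz

lemma isSteps_append {l r : List ℤ} : IsSteps (l ++ r) ↔ IsSteps l ∧ IsSteps r := by
  simp [IsSteps, or_imp, forall_and]

/-- The set of points that the path with the given steps visits before its last time. -/
def visited (l : List ℤ) : Set ℤ := {z | ∃ i < l.length, (l.take i).sum = z}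

lemma visited_append (l r : List ℤ) :
    visited (l ++ r) = visited l ∪ (fun z => l.sum + z) '' visited r := by
  ext z
  constructor
  · rintro ⟨i, hi, rfl⟩
    rcases lt_or_ge i l.length with h | h
    · exact Or.inl ⟨i, h, by rw [List.take_append_of_le_length h.le]⟩
    · refine Or.inr ⟨_, ⟨i - l.length, ?_, rfl⟩, ?_⟩
      · rw [List.length_append] at hi; omega
      · obtain ⟨j, rfl⟩ := Nat.exists_eq_add_of_le h
        simp [List.take_length_add_append]
  · rintro (⟨i, hi, rfl⟩ | ⟨_, ⟨i, hi, rfl⟩, rfl⟩)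
    · exact ⟨i, by rw [List.length_append]; omega, by rw [List.take_append_of_le_length hi.le]⟩
    · exact ⟨l.length + i, by rw [List.length_append]; omega, by
        simp [List.take_length_add_append]⟩

lemma visited_signed (e : ℤˣ) (l : List ℤ) :
    visited (signed e l) = (fun z => (e : ℤ) * z) '' visited l := by
  ext z
  constructor
  · rintro ⟨i, hi, rfl⟩
    exact ⟨_, ⟨i, by simpa using hi, rfl⟩, by simp⟩
  · rintro ⟨_, ⟨i, hi, rfl⟩, rfl⟩
    exact ⟨i, by simpa using hi, by simp⟩

/-- The path with the given steps ends at `h`, when it leaves `(-h, h)` for the first time. -/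
structure FirstPassage (h : ℤ) (l : List ℤ) : Prop where
  isSteps : IsSteps l
  sum_eq : l.sum = h
  abs_lt : ∀ i < l.length, |(l.take i).sum| < h

/-- Unique decoding: the first time at which `|sum|` reaches `h` determines the length of the first
block, and the position at that time determines its sign. -/
lemma FirstPassage.append_inj {h : ℤ} (hh : 0 < h) {l₁ l₂ r₁ r₂ : List ℤ} {e₁ e₂ : ℤˣ}
    (h₁ : FirstPassage h l₁) (h₂ : FirstPassage h l₂)
    (he : signed e₁ l₁ ++ r₁ = signed e₂ l₂ ++ r₂) : e₁ = e₂ ∧ l₁ = l₂ ∧ r₁ = r₂ := by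
  have aux : ∀ {l₁ l₂ r₁ r₂ : List ℤ} {e₁ e₂ : ℤˣ}, FirstPassage h l₁ → FirstPassage h l₂ →
      signed e₁ l₁ ++ r₁ = signed e₂ l₂ ++ r₂ → ¬ l₁.length < l₂.length := by
    intro l₁ l₂ r₁ r₂ e₁ e₂ h₁ h₂ he hlt
    have h3 := congrArg (List.take l₁.length) he
    rw [List.take_append_of_le_length (by simp),
      List.take_append_of_le_length (by simpa using hlt.le),
      signed_take, signed_take, List.take_length] at h3
    have h4 := congrArg (fun l => |List.sum l|) h3
    simp only [signed_sum, abs_unit_mul, h₁.sum_eq, abs_of_pos hh] at h4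
    exact absurd (h₂.abs_lt _ hlt) (by rw [← h4]; exact lt_irrefl _)
  have hlen : l₁.length = l₂.length :=
    le_antisymm (not_lt.1 (aux h₂ h₁ he.symm)) (not_lt.1 (aux h₁ h₂ he))
  obtain ⟨h5, h6⟩ := List.append_inj he (by simpa using hlen)
  have h7 := congrArg List.sum h5
  rw [signed_sum, signed_sum, h₁.sum_eq, h₂.sum_eq] at h7
  have h8 : e₁ = e₂ := Units.ext (mul_right_cancel₀ hh.ne' h7)
  subst h8
  refine ⟨rfl, ?_, h6⟩
  rw [← signed_self e₁ l₁, h5, signed_self]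

/-- Cut at the first index where `|sum| ≥ h`; unit steps cannot overshoot, so equality holds there.
-/
lemma IsSteps.exists_firstPassage {h : ℤ} (hh : 0 < h) {l : List ℤ} (hl : IsSteps l)
    {i : ℕ} (hi : h ≤ |(l.take i).sum|) :
    ∃ (e : ℤˣ) (p r : List ℤ), FirstPassage h p ∧ l = signed e p ++ r := by
  classical
  have hex : ∃ i, h ≤ |(l.take i).sum| := ⟨i, hi⟩
  set k := Nat.find hex with hk
  have hk1 : h ≤ |(l.take k).sum| := Nat.find_spec hex
  have hk2 : ∀ j < k, |(l.take j).sum| < h := fun j hj => not_le.1 (Nat.find_min hex hj)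
  have hkpos : k ≠ 0 := fun h0 => by simp [h0] at hk1; omega
  obtain ⟨m, hm⟩ := Nat.exists_eq_succ_of_ne_zero hkpos
  have hmlt : m < l.length := by
    by_contra hge
    have h1 := hk2 m (by omega)
    rw [List.take_of_length_le (by omega)] at h1 hk1
    omega
  have hsum : (l.take k).sum = (l.take m).sum + l[m] := by
    rw [hm, Nat.succ_eq_add_one, List.sum_take_succ _ _ hmlt]
  have habs : |(l.take k).sum| = h := by
    have h1 := hk2 m (by omega)
    have h2 := hl _ (List.getElem_mem hmlt)
    have h3 := abs_add_le (l.take m).sum l[m]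
    rw [← hsum] at h3
    omega
  obtain ⟨e, he⟩ : ∃ e : ℤˣ, (e : ℤ) * (l.take k).sum = h := by
    rcases abs_eq hh.le |>.1 habs with h1 | h1
    · exact ⟨1, by simp [h1]⟩
    · exact ⟨-1, by simp [h1]⟩
  refine ⟨e, signed e (l.take k), l.drop k, ⟨?_, ?_, fun j hj => ?_⟩, ?_⟩
  · refine isSteps_signed (fun s hs => hl s (List.mem_of_mem_take hs)) e
  · simpa using he
  · rw [signed_length, List.length_take] at hj
    rw [signed_take, signed_sum, abs_unit_mul, List.take_take, min_eq_left (by omega)]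
    exact hk2 j (by omega)
  · rw [signed_self, List.take_append_drop]

/-! ### Trees describing the hierarchical decomposition of first-passage paths -/

/-- The hierarchical decompositions of the paths that first leave `(-2^N, 2^N)` at `2^N`. Such a
path of level `N + 1` consists of excursions to `±2^N` and back to `0`, followed by a passage
from `0` to `2^N` and from there to `2^(N+1)`. -/
inductive PathTree : ℕ → Type
  | unit : PathTree 0
  | final {N : ℕ} (a b : PathTree N) : PathTree (N + 1)
  | exc {N : ℕ} (e : ℤˣ) (a b : PathTree N) (r : PathTree (N + 1)) : PathTree (N + 1)

namespace PathTree

/-- The list of steps of the path described by a tree. -/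
def steps : {N : ℕ} → PathTree N → List ℤ
  | _, unit => [1]
  | _, final a b => a.steps ++ b.steps
  | _, exc e a b r => signed e a.steps ++ (signed (-e) b.steps ++ r.steps)

/-- Minus the minimum of the path described by a tree. -/
def low : {N : ℕ} → PathTree N → ℕ
  | _, unit => 0
  | _, final a _ => a.low
  | _, exc (N := N) e a b r => if e = 1 then max a.low r.low else max (2 ^ N + b.low) r.low

lemma low_lt {N : ℕ} (t : PathTree N) : t.low < 2 ^ N := by
  induction t with
  | unit => simp [low]
  | final a b iha ihb => rw [low, pow_succ]; omega
  | exc e a b r iha ihb ihr =>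
    rw [low]
    rw [pow_succ] at *
    split_ifs <;> omega

lemma steps_isSteps {N : ℕ} (t : PathTree N) : IsSteps t.steps := by
  induction t with
  | unit => simp [steps, IsSteps]
  | final a b iha ihb => exact isSteps_append.2 ⟨iha, ihb⟩
  | exc e a b r iha ihb ihr =>
    exact isSteps_append.2 ⟨isSteps_signed iha e, isSteps_append.2 ⟨isSteps_signed ihb _, ihr⟩⟩

lemma steps_sum {N : ℕ} (t : PathTree N) : t.steps.sum = 2 ^ N := by
  induction t with
  | unit => simp [steps]
  | final a b iha ihb => rw [steps, List.sum_append, iha, ihb, pow_succ]; ring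
  | exc e a b r iha ihb ihr =>
    rw [steps, List.sum_append, List.sum_append, signed_sum, signed_sum, iha, ihb, ihr]
    push_cast
    ring

/-- The last point is not counted, so the remainder `r` already covers `[0, 2^(N+1) - 1]` and only
the minimum matters. In an excursion to the right the second piece stays in `[1, 2^(N+1) - 1]`. In
an excursion to the left it starts at `-2^N` and goes `b.low` further down, below everything the
first piece reaches. -/
lemma visited_steps {N : ℕ} (t : PathTree N) :
    visited t.steps = Icc (-(t.low : ℤ)) (2 ^ N - 1) := by
  induction t with
  | unit =>
    ext z
    constructor
    · rintro ⟨i, hi, rfl⟩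
      have : i = 0 := by simpa [steps] using hi
      simp [this, low]
    · intro h
      have : z = 0 := by simp [low] at h; omega
      exact ⟨0, by simp [steps], by simp [this]⟩
  | @final N a b iha ihb =>
    have h1 : (a.low : ℤ) < 2 ^ N := by exact_mod_cast a.low_lt
    have h2 : (b.low : ℤ) < 2 ^ N := by exact_mod_cast b.low_lt
    rw [steps, visited_append, iha, ihb, a.steps_sum, image_const_add_Icc, low, pow_succ]
    ext z
    simp only [mem_union, mem_Icc]
    omega
  | @exc N e a b r iha ihb ihr =>
    have h1 : (a.low : ℤ) < 2 ^ N := by exact_mod_cast a.low_lt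
    have h2 : (b.low : ℤ) < 2 ^ N := by exact_mod_cast b.low_lt
    have h3 : (r.low : ℤ) < 2 ^ (N + 1) := by exact_mod_cast r.low_lt
    rw [steps, visited_append, visited_append, visited_signed, visited_signed, iha, ihb, ihr,
      signed_sum, signed_sum, a.steps_sum, b.steps_sum, low]
    rw [pow_succ] at *
    rcases Int.units_eq_one_or e with rfl | rfl
    · ext z
      simp
      omega
    · ext z
      simp
      omega

lemma firstPassage_steps {N : ℕ} (t : PathTree N) : FirstPassage (2 ^ N) t.steps := by
  refine ⟨t.steps_isSteps, t.steps_sum, fun i hi => ?_⟩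
  have h1 : (t.low : ℤ) < 2 ^ N := by exact_mod_cast t.low_lt
  have h2 : (t.steps.take i).sum ∈ visited t.steps := ⟨i, hi, rfl⟩
  rw [visited_steps] at h2
  rw [abs_lt]
  constructor <;> linarith [h2.1, h2.2]

lemma steps_append_inj {N : ℕ} {a b : PathTree N} {e f : ℤˣ} {r s : List ℤ}
    (h : signed e a.steps ++ r = signed f b.steps ++ s) :
    e = f ∧ a.steps = b.steps ∧ r = s :=
  a.firstPassage_steps.append_inj (by positivity) b.firstPassage_steps h

lemma steps_ne_nil {N : ℕ} (t : PathTree N) : t.steps ≠ [] := fun h => by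
  have := t.steps_sum
  rw [h, List.sum_nil] at this
  exact absurd this (by positivity)

/-- Blocks are decoded one at a time. A final passage has block signs `1, 1`, an excursion has `e,
-e`, so the constructors cannot be confused. -/
lemma steps_injective {N : ℕ} : Function.Injective (steps : PathTree N → List ℤ) := by
  intro t t' h
  induction t with
  | unit => cases t'; rfl
  | final a b iha ihb =>
    cases t' with
    | final a' b' =>
      obtain ⟨-, h1, h2⟩ := steps_append_inj (e := 1) (f := 1) (by simpa [steps] using h)
      rw [iha h1, ihb h2]
    | exc e' a' b' r' =>
      obtain ⟨h0, -, h2⟩ := steps_append_inj (e := 1) (by simpa [steps] using h)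
      subst h0
      obtain ⟨h0, -, -⟩ := steps_append_inj (e := 1) (r := []) (by simpa using h2)
      exact absurd h0 (by decide)
  | exc e a b r iha ihb ihr =>
    cases t' with
    | final a' b' =>
      obtain ⟨h0, -, h2⟩ := steps_append_inj (f := 1) (by simpa [steps] using h)
      subst h0
      obtain ⟨h0, -, -⟩ := steps_append_inj (f := 1) (s := []) (by simpa using h2)
      exact absurd h0 (by decide)
    | exc e' a' b' r' =>
      obtain ⟨h0, h1, h2⟩ := steps_append_inj h
      obtain ⟨-, h3, h4⟩ := steps_append_inj h2
      rw [h0, iha h1, ihb h3, ihr h4]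

instance {N : ℕ} : Countable (PathTree N) := steps_injective.countable

/-- Cut off two blocks of level `N`. Opposite signs bring the path back to `0`, and the shorter rest
is again a first-passage path. Equal signs bring it to `±2^(N+1)`, where it must stop, and its
endpoint makes the sign positive. -/
lemma exists_steps_eq {N : ℕ} {l : List ℤ} (hl : FirstPassage (2 ^ N) l) :
    ∃ t : PathTree N, t.steps = l := by
  induction N generalizing l with
  | zero =>
    match l, hl with
    | [], hl => exact absurd hl.sum_eq (by simp)
    | [s], hl => exact ⟨unit, by simpa [steps] using hl.sum_eq.symm⟩
    | s :: s' :: l, hl =>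
      have h1 := hl.abs_lt 1 (by simp)
      have h2 := hl.isSteps s (by simp)
      simp at h1
      simp [h1] at h2
  | succ N ih =>
    have hh : (0 : ℤ) < 2 ^ N := by positivity
    generalize hn : l.length = n
    induction n using Nat.strong_induction_on generalizing l with
    | _ n ihn =>
    have hsum := hl.sum_eq
    rw [pow_succ] at hsum
    obtain ⟨e, p, r, hp, rfl⟩ := IsSteps.exists_firstPassage hh hl.isSteps (i := l.length) (by
      rw [List.take_length, hsum, abs_of_pos (by positivity)]; linarith)
    have hr := (isSteps_append.1 hl.isSteps).2
    have hrsum : r.sum = 2 ^ N * 2 - e * 2 ^ N := by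
      rw [List.sum_append, signed_sum, hp.sum_eq] at hsum; linarith
    obtain ⟨e', q, r', hq, rfl⟩ := IsSteps.exists_firstPassage hh hr (i := r.length) (by
      rw [List.take_length, hrsum]
      rcases Int.units_eq_one_or e with rfl | rfl <;> simp <;>
        rw [abs_of_pos (by linarith)] <;> linarith)
    have hr' := (isSteps_append.1 hr).2
    obtain ⟨a, rfl⟩ := ih hp
    obtain ⟨b, rfl⟩ := ih hq
    rw [List.sum_append, signed_sum, b.steps_sum] at hrsum
    have hlen : 0 < a.steps.length := List.length_pos_iff.2 a.steps_ne_nil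
    have htake : ∀ i, ((signed e a.steps ++ (signed e' b.steps ++ r')).take
        (a.steps.length + (b.steps.length + i))).sum =
        e * 2 ^ N + (e' * 2 ^ N + (r'.take i).sum) := fun i => by
      have h1 := List.take_length_add_append (l₁ := signed e a.steps)
        (l₂ := signed e' b.steps ++ r') (b.steps.length + i)
      have h2 := List.take_length_add_append (l₁ := signed e' b.steps) (l₂ := r') i
      rw [signed_length] at h1 h2
      rw [h1, h2, List.sum_append, List.sum_append, signed_sum, signed_sum, a.steps_sum,
        b.steps_sum]
    by_cases hee : e' = -e
    · subst hee
      have hfp : FirstPassage (2 ^ (N + 1)) r' := by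
        refine ⟨hr', ?_, fun i hi => ?_⟩
        · rw [pow_succ]; push_cast at hrsum; linarith
        · have := hl.abs_lt (a.steps.length + (b.steps.length + i)) (by simpa using hi)
          rw [htake] at this
          convert this using 2
          push_cast; ring
      obtain ⟨t, rfl⟩ := ihn r'.length (by subst hn; simp; omega) hfp rfl
      exact ⟨exc e a b t, rfl⟩
    · have hee' : e' = e := by
        rcases Int.units_eq_one_or e with rfl | rfl <;>
          rcases Int.units_eq_one_or e' with rfl | rfl <;> simp_all
      subst hee'
      have hnil : r' = [] := by
        by_contra hne
        have := hl.abs_lt (a.steps.length + (b.steps.length + 0))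
          (by simpa using List.length_pos_iff.2 hne)
        rw [htake, List.take_zero, List.sum_nil, add_zero, ← mul_add, abs_unit_mul,
          abs_of_pos (by positivity), pow_succ] at this
        linarith
      subst hnil
      have he1 : e' = 1 := by
        rcases Int.units_eq_one_or e' with rfl | rfl
        · rfl
        · simp at hrsum; linarith
      subst he1
      exact ⟨final a b, by simp [steps]⟩

end PathTree

/-! ### Weights of trees -/

namespace PathTree

/-- The probability of the path described by a tree. -/
noncomputable def weight (u : ℝ) : {N : ℕ} → PathTree N → ℝ
  | _, unit => 1
  | _, final a b => xParam u * (a.weight u * b.weight u)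
  | _, exc _ a b r => u ^ 2 * xParam u ^ 2 * (a.weight u * b.weight u) * r.weight u

lemma weight_nonneg (u : ℝ) {N : ℕ} (t : PathTree N) : 0 ≤ t.weight u := by
  have := (xParam_pos u).le
  induction t with
  | unit => exact zero_le_one
  | final a b iha ihb => exact mul_nonneg this (mul_nonneg iha ihb)
  | exc e a b r iha ihb ihr =>
    exact mul_nonneg (mul_nonneg (by positivity) (mul_nonneg iha ihb)) ihr

/-- The weight of a tree as an extended nonnegative real. -/
noncomputable def mass (u : ℝ) {N : ℕ} (t : PathTree N) : ℝ≥0∞ := ENNReal.ofReal (t.weight u)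

lemma mass_unit (u : ℝ) : mass u unit = 1 := by simp [mass, weight]

lemma mass_final (u : ℝ) {N : ℕ} (a b : PathTree N) :
    mass u (final a b) = ENNReal.ofReal (xParam u) * (mass u a * mass u b) := by
  simp only [mass, weight]
  rw [ENNReal.ofReal_mul (xParam_pos u).le, ENNReal.ofReal_mul (a.weight_nonneg u)]

lemma mass_exc (u : ℝ) {N : ℕ} (e : ℤˣ) (a b : PathTree N) (r : PathTree (N + 1)) :
    mass u (exc e a b r) =
      ENNReal.ofReal ((1 - xParam u) / 2) * (mass u a * mass u b) * mass u r := by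
  have h := xParam_le_one u
  simp only [mass, weight, xParam_quadratic]
  have h1 : 0 ≤ (1 - xParam u) / 2 := by linarith
  have h2 := a.weight_nonneg u
  have h3 := b.weight_nonneg u
  rw [ENNReal.ofReal_mul (by positivity), ENNReal.ofReal_mul h1, ENNReal.ofReal_mul h2]

/-- The number of excursions. -/
def excursions {N : ℕ} : PathTree (N + 1) → ℕ
  | final _ _ => 0
  | exc _ _ _ r => r.excursions + 1

/-- A tree is either a final passage or an excursion followed by a tree. -/
def succEquiv (N : ℕ) : PathTree (N + 1) ≃
    (PathTree N × PathTree N) ⊕ (PathTree (N + 1) × ℤˣ × PathTree N × PathTree N) where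
  toFun
    | final a b => Sum.inl (a, b)
    | exc e a b r => Sum.inr (r, e, a, b)
  invFun
    | Sum.inl (a, b) => final a b
    | Sum.inr (r, e, a, b) => exc e a b r
  left_inv t := by cases t <;> rfl
  right_inv s := by rcases s with ⟨a, b⟩ | ⟨r, e, a, b⟩ <;> rfl

lemma tsum_succ {N : ℕ} (g : PathTree (N + 1) → ℝ≥0∞) :
    ∑' t, g t = (∑' a, ∑' b, g (final a b)) + ∑' r, ∑' e, ∑' a, ∑' b, g (exc e a b r) := by
  rw [← (succEquiv N).symm.tsum_eq, ENNReal.summable.tsum_sum (by exact ENNReal.summable)]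
  · congr 1
    · rw [ENNReal.tsum_prod']; rfl
    · rw [ENNReal.tsum_prod']
      congr 1; ext r
      rw [ENNReal.tsum_prod']
      congr 1; ext e
      rw [ENNReal.tsum_prod']; rfl

/-- Summing a function that is multiplicative over excursions gives a geometric series. -/
lemma tsum_eq_of_multiplicative {N : ℕ} {g : PathTree (N + 1) → ℝ≥0∞}
    {κ : ℤˣ → PathTree N → PathTree N → ℝ≥0∞}
    (h : ∀ e a b r, g (exc e a b r) = κ e a b * g r) :
    ∑' t, g t = (∑' a, ∑' b, g (final a b)) * (1 - ∑' e, ∑' a, ∑' b, κ e a b)⁻¹ := by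
  classical
  set K := ∑' e, ∑' a, ∑' b, κ e a b with hK
  set S := ∑' a, ∑' b, g (final a b) with hS
  -- The sum is sliced by the number of excursions. In `ℝ≥0∞` the geometric series needs no bound on
  -- `K`.
  let G : ℕ → ℝ≥0∞ := fun k => ∑' t : PathTree (N + 1), if t.excursions = k then g t else 0
  have hG : ∀ k, G k = S * K ^ k := fun k => by
    induction k with
    | zero =>
      simp only [G]
      rw [tsum_succ]
      simp [excursions, hS]
    | succ k ih =>
      have h1 : G (k + 1) = K * G k := by
        simp only [G]
        rw [tsum_succ]
        simp only [excursions, Nat.add_right_cancel_iff, h]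
        simp only [Nat.zero_ne_add_one, if_false, tsum_zero, zero_add,
          ← mul_ite_zero, ENNReal.tsum_mul_right, ENNReal.tsum_mul_left]
        simp [hK]
      rw [h1, ih, pow_succ]; ring
  calc ∑' t, g t = ∑' t : PathTree (N + 1), ∑' k, if t.excursions = k then g t else 0 := by
        congr 1; ext t; exact (tsum_ite_eq' t.excursions fun _ => g t).symm
    _ = ∑' k, G k := ENNReal.tsum_comm
    _ = S * (1 - K)⁻¹ := by simp_rw [hG, ENNReal.tsum_mul_left, ENNReal.tsum_geometric]

lemma tsum_intUnits (f : ℤˣ → ℝ≥0∞) : ∑' e, f e = f 1 + f (-1) := by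
  rw [tsum_fintype, show (Finset.univ : Finset ℤˣ) = {1, -1} from rfl,
    Finset.sum_pair (by decide)]

lemma ofReal_xParam_mul_inv (u : ℝ) : ENNReal.ofReal (xParam u) *
    (1 - 2 * ENNReal.ofReal ((1 - xParam u) / 2))⁻¹ = 1 := by
  have h0 := xParam_pos u
  have h1 := xParam_le_one u
  have e : (1 : ℝ≥0∞) - 2 * ENNReal.ofReal ((1 - xParam u) / 2) = ENNReal.ofReal (xParam u) := by
    rw [← ENNReal.ofReal_one, ← ENNReal.ofReal_ofNat 2, ← ENNReal.ofReal_mul (by norm_num),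
      ← ENNReal.ofReal_sub _ (by linarith)]
    congr 1; ring
  rw [e]
  exact ENNReal.mul_inv_cancel (by simpa using h0) ENNReal.ofReal_ne_top

lemma tsum_mass (u : ℝ) (N : ℕ) : ∑' t : PathTree N, mass u t = 1 := by
  induction N with
  | zero =>
    rw [tsum_eq_single unit (fun t ht => absurd (by cases t; rfl) ht), mass_unit]
  | succ N ih =>
    rw [tsum_eq_of_multiplicative (fun e a b r => mass_exc u e a b r)]
    simp_rw [mass_final, ENNReal.tsum_mul_left, ENNReal.tsum_mul_right, ih]
    rw [tsum_intUnits, ← two_mul]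
    simp only [mul_one, mul_comm _ (2 : ℝ≥0∞)]
    exact ofReal_xParam_mul_inv u

/-- The rescaled depth of the path described by a tree. -/
noncomputable def relLow {N : ℕ} (t : PathTree N) : ℝ := t.low / 2 ^ N

lemma relLow_nonneg {N : ℕ} (t : PathTree N) : 0 ≤ t.relLow := by unfold relLow; positivity

lemma relLow_lt_one {N : ℕ} (t : PathTree N) : t.relLow < 1 := by
  rw [relLow, div_lt_one (by positivity)]
  exact_mod_cast t.low_lt

lemma relLow_final {N : ℕ} (a b : PathTree N) : (final a b).relLow = a.relLow / 2 := by
  rw [relLow, relLow, low, pow_succ, div_div]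

lemma relLow_exc_one {N : ℕ} (a b : PathTree N) (r : PathTree (N + 1)) :
    (exc 1 a b r).relLow = max (a.relLow / 2) r.relLow := by
  rw [relLow, relLow, relLow, low, if_pos rfl, Nat.cast_max, div_div, ← pow_succ,
    max_div_div_right (by positivity)]

lemma relLow_exc_neg_one {N : ℕ} (a b : PathTree N) (r : PathTree (N + 1)) :
    (exc (-1) a b r).relLow = max ((1 + b.relLow) / 2) r.relLow := by
  have h : (1 + (b.low : ℝ) / 2 ^ N) / 2 = (2 ^ N + b.low) / 2 ^ (N + 1) := by
    rw [pow_succ]; field_simp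
  rw [relLow, relLow, relLow, low, if_neg (by decide), Nat.cast_max, h,
    max_div_div_right (by positivity)]
  push_cast
  rfl

/-- The weight of a tree if its rescaled depth is at most `y`, and `0` otherwise. -/
noncomputable def massLe (u y : ℝ) {N : ℕ} (t : PathTree N) : ℝ≥0∞ :=
  if t.relLow ≤ y then mass u t else 0

/-- The depth is a maximum, so the bound `y` constrains each excursion separately. For `y < 1/2`
left excursions are excluded and the first piece of the others must have depth at most `2y`. For `y
≥ 1/2` only the second piece of a left excursion is constrained, to depth at most `2y - 1`. -/
lemma tsum_massLe (u : ℝ) (N : ℕ) (y : ℝ) :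
    ∑' t : PathTree N, massLe u y t = ENNReal.ofReal (approxCdf (xParam u) N y) := by
  have h0 := xParam_pos u
  have h1 := xParam_le_one u
  have hA : 0 ≤ (1 - xParam u) / 2 := by linarith
  induction N generalizing y with
  | zero =>
    rw [tsum_eq_single unit (fun t ht => absurd (by cases t; rfl) ht)]
    simp only [massLe, mass_unit, relLow, low, approxCdf]
    norm_num
    split_ifs <;> simp
  | succ N ih =>
    have hm := approxCdf_mem h0 h1 N
    rw [approxCdf]
    split_ifs with hy
    · have e1 : ∀ a : PathTree N, a.relLow / 2 ≤ y ↔ a.relLow ≤ 2 * y := fun a => by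
        constructor <;> intro <;> linarith
      have e2 : ∀ b : PathTree N, ¬ (1 + b.relLow) / 2 ≤ y := fun b => by
        linarith [b.relLow_nonneg]
      have k0 : ∀ a b : PathTree N, massLe u y (final a b) =
          ENNReal.ofReal (xParam u) * (massLe u (2 * y) a * mass u b) := fun a b => by
        simp only [massLe, relLow_final, e1, mass_final]
        split_ifs <;> simp
      rw [tsum_eq_of_multiplicative
        (κ := fun e a b => if e = 1 then ENNReal.ofReal ((1 - xParam u) / 2) *
          (massLe u (2 * y) a * mass u b) else 0)]
      · have hd := leftBranch_denom_pos h0 (hm (2 * y))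
        rw [tsum_intUnits]
        simp only [k0, if_true, show ¬ ((-1 : ℤˣ) = 1) by decide, if_false, tsum_zero, add_zero,
          ENNReal.tsum_mul_left, tsum_mass, mul_one, ih]
        rw [← ENNReal.ofReal_mul hA, ← ENNReal.ofReal_mul h0.le, ← ENNReal.ofReal_one,
          ← ENNReal.ofReal_sub _ (mul_nonneg hA (hm _).1), ← ENNReal.ofReal_inv_of_pos hd,
          ← ENNReal.ofReal_mul (mul_nonneg h0.le (hm _).1), leftBranch, ← div_eq_mul_inv]
      · intro e a b r
        rcases Int.units_eq_one_or e with rfl | rfl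
        · simp only [massLe, relLow_exc_one, max_le_iff, e1, mass_exc, if_true]
          by_cases c1 : a.relLow ≤ 2 * y <;> by_cases c2 : r.relLow ≤ y <;> simp [c1, c2]
        · simp only [massLe, relLow_exc_neg_one, max_le_iff, e2, false_and, if_false,
            show ¬ ((-1 : ℤˣ) = 1) by decide, zero_mul]
    · have e1 : ∀ a : PathTree N, a.relLow / 2 ≤ y := fun a => by
        linarith [a.relLow_lt_one]
      have e2 : ∀ b : PathTree N, (1 + b.relLow) / 2 ≤ y ↔ b.relLow ≤ 2 * y - 1 := fun a => by
        constructor <;> intro <;> linarith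
      have k0 : ∀ a b : PathTree N, massLe u y (final a b) =
          ENNReal.ofReal (xParam u) * (mass u a * mass u b) := fun a b => by
        simp only [massLe, relLow_final, e1, mass_final, if_true]
      rw [tsum_eq_of_multiplicative
        (κ := fun e a b => ENNReal.ofReal ((1 - xParam u) / 2) *
          (mass u a * (if e = 1 then mass u b else massLe u (2 * y - 1) b)))]
      · have hd := rightBranch_denom_pos h0 (hm (2 * y - 1))
        rw [tsum_intUnits]
        simp only [k0, if_true, show ¬ ((-1 : ℤˣ) = 1) by decide, if_false,
          ENNReal.tsum_mul_left, ENNReal.tsum_mul_right, tsum_mass, mul_one, one_mul, ih]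
        rw [← ENNReal.ofReal_mul hA, ← ENNReal.ofReal_add hA (mul_nonneg hA (hm _).1),
          ← mul_one_add, ← ENNReal.ofReal_one, ← ENNReal.ofReal_sub _
            (mul_nonneg hA (add_nonneg zero_le_one (hm _).1)), ← ENNReal.ofReal_inv_of_pos hd,
          ← ENNReal.ofReal_mul h0.le, rightBranch, ← div_eq_mul_inv]
      · intro e a b r
        rcases Int.units_eq_one_or e with rfl | rfl
        · simp only [massLe, relLow_exc_one, max_le_iff, mass_exc, e1, true_and, if_true]
          split_ifs <;> simp
        · simp only [massLe, relLow_exc_neg_one, max_le_iff, e2, mass_exc,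
            show ¬ ((-1 : ℤˣ) = 1) by decide, if_false]
          by_cases c1 : b.relLow ≤ 2 * y - 1 <;> by_cases c2 : r.relLow ≤ y <;> simp [c1, c2]

end PathTree

/-! ### Decimation of paths that are concatenations of signed blocks -/

/-- The path `ω` has the steps `l`. -/
structure FinPath.HasSteps (ω : FinPath) (l : List ℤ) : Prop where
  len_eq : ω.len = l.length
  pos_eq : ∀ i ≤ l.length, ω.pos i = (l.take i).sum

/-- The concatenation of signed paths. -/
def concatSteps {N : ℕ} (bs : List (ℤˣ × PathTree N)) : List ℤ :=
  bs.flatMap fun p => signed p.1 p.2.steps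

/-- The time at which the `i`-th block of a concatenation ends. -/
def blockTime {N : ℕ} (bs : List (ℤˣ × PathTree N)) (i : ℕ) : ℕ := (concatSteps (bs.take i)).length

section Blocks

variable {N : ℕ} {bs : List (ℤˣ × PathTree N)}

lemma concatSteps_sum_dvd (bs : List (ℤˣ × PathTree N)) : (2 : ℤ) ^ N ∣ (concatSteps bs).sum := by
  induction bs with
  | nil => simp [concatSteps]
  | cons p bs ih =>
    rw [concatSteps, List.flatMap_cons, List.sum_append, signed_sum, p.2.steps_sum]
    exact dvd_add (dvd_mul_left _ _) ih

lemma concatSteps_eq {i : ℕ} (hi : i < bs.length) :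
    concatSteps bs = concatSteps (bs.take i) ++
      (signed bs[i].1 bs[i].2.steps ++ concatSteps (bs.drop (i + 1))) := by
  conv_lhs => rw [← List.take_append_drop i bs, List.drop_eq_getElem_cons hi]
  rw [concatSteps, List.flatMap_append, List.flatMap_cons]
  rfl

lemma blockTime_zero (bs : List (ℤˣ × PathTree N)) : blockTime bs 0 = 0 := by
  simp [blockTime, concatSteps]

lemma blockTime_length (bs : List (ℤˣ × PathTree N)) :
    blockTime bs bs.length = (concatSteps bs).length := by simp [blockTime]

lemma blockTime_succ {i : ℕ} (hi : i < bs.length) :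
    blockTime bs (i + 1) = blockTime bs i + bs[i].2.steps.length := by
  rw [blockTime, List.take_succ_eq_append_getElem hi, concatSteps, List.flatMap_append,
    List.length_append, List.flatMap_singleton, signed_length]
  rfl

lemma blockTime_add_le {i : ℕ} (hi : i < bs.length) :
    blockTime bs i + bs[i].2.steps.length ≤ (concatSteps bs).length := by
  rw [concatSteps_eq hi, blockTime]
  simp only [List.length_append, signed_length]
  omega

variable {ω : FinPath}

lemma FinPath.HasSteps.pos_blockTime_add (hω : ω.HasSteps (concatSteps bs)) {i k : ℕ}
    (hi : i < bs.length)
    (hk : k ≤ bs[i].2.steps.length) :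
    ω.pos (blockTime bs i + k) =
      (concatSteps (bs.take i)).sum + bs[i].1 * (bs[i].2.steps.take k).sum := by
  rw [hω.pos_eq _ ((Nat.add_le_add_left hk _).trans (blockTime_add_le hi))]
  conv_lhs => rw [concatSteps_eq hi, blockTime, List.take_length_add_append,
    List.take_append_of_le_length (by simpa using hk)]
  simp

lemma FinPath.HasSteps.pos_blockTime (hω : ω.HasSteps (concatSteps bs)) {i : ℕ}
    (hi : i < bs.length) :
    ω.pos (blockTime bs i) = (concatSteps (bs.take i)).sum := by
  simpa using hω.pos_blockTime_add hi (Nat.zero_le _)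

lemma FinPath.HasSteps.pos_blockTime_succ (hω : ω.HasSteps (concatSteps bs)) {i : ℕ}
    (hi : i < bs.length) :
    ω.pos (blockTime bs (i + 1)) = (concatSteps (bs.take i)).sum + bs[i].1 * 2 ^ N := by
  rw [blockTime_succ hi, hω.pos_blockTime_add hi le_rfl, List.take_length, PathTree.steps_sum]

/-- Blocks start in `2^N ℤ` and move by less than `2^N` before their end. So the only multiple of
`2^N` met earlier is the starting point itself, which the definition excludes. -/
lemma FinPath.HasSteps.decTime_eq (hω : ω.HasSteps (concatSteps bs)) {i : ℕ} (hi : i ≤ bs.length) :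
    ω.decTime N i = (blockTime bs i : ℕ∞) := by
  induction i with
  | zero => simp [FinPath.decTime, blockTime_zero]
  | succ i ih =>
    have hi' : i < bs.length := hi
    have hlen := blockTime_succ hi'
    have hpos : 0 < bs[i].2.steps.length := List.length_pos_iff.2 bs[i].2.steps_ne_nil
    have h2 : (0 : ℤ) < 2 ^ N := by positivity
    rw [FinPath.decTime, ih hi'.le, ENat.toNat_natCast]
    refine le_antisymm (sInf_le ⟨_, rfl, ?_, ?_, ?_, ?_⟩) (le_sInf ?_)
    · rw [Nat.cast_lt]; omega
    · rw [hω.len_eq, hlen]; exact blockTime_add_le hi'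
    · rw [hω.pos_blockTime_succ hi']
      exact dvd_add (concatSteps_sum_dvd _) (dvd_mul_left _ _)
    · rw [hω.pos_blockTime_succ hi', hω.pos_blockTime hi']
      have : (bs[i].1 : ℤ) * 2 ^ N ≠ 0 := mul_ne_zero (Units.ne_zero _) h2.ne'
      omega
    · rintro _ ⟨j, rfl, hj, -, hdvd, hne⟩
      rw [Nat.cast_lt] at hj
      rw [Nat.cast_le]
      by_contra hlt
      obtain ⟨k, rfl⟩ := Nat.exists_eq_add_of_lt hj
      rw [add_assoc] at hdvd hne
      rw [hω.pos_blockTime_add hi' (by omega)] at hdvd hne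
      rw [hω.pos_blockTime hi'] at hne
      rw [dvd_add_right (concatSteps_sum_dvd _)] at hdvd
      have habs := bs[i].2.firstPassage_steps.abs_lt (k + 1) (by omega)
      rw [← abs_unit_mul bs[i].1] at habs
      exact hne (by rw [Int.eq_zero_of_abs_lt_dvd hdvd habs, add_zero])

lemma FinPath.HasSteps.decTime_eq_top (hω : ω.HasSteps (concatSteps bs)) {i : ℕ}
    (hi : bs.length < i) : ω.decTime N i = ⊤ := by
  induction i with
  | zero => omega
  | succ i ih =>
    rw [FinPath.decTime]
    refine sInf_eq_top.2 ?_
    rintro _ ⟨j, rfl, hj, hj2, -, -⟩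
    exfalso
    rcases (Nat.lt_succ_iff.1 hi).lt_or_eq with h | h
    · rw [ih h] at hj
      exact not_top_lt hj
    · subst h
      rw [hω.decTime_eq le_rfl, Nat.cast_lt, blockTime_length, ← hω.len_eq] at hj
      omega

lemma FinPath.HasSteps.decimate_len (hω : ω.HasSteps (concatSteps bs)) :
    (ω.decimate N).len = bs.length := by
  have : {i : ℕ | ω.decTime N i < ⊤} = Iic bs.length := by
    ext i
    simp only [mem_ofPred_eq, mem_Iic]
    constructor
    · intro h
      by_contra hlt
      rw [hω.decTime_eq_top (not_le.1 hlt)] at h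
      exact lt_irrefl _ h
    · intro h
      rw [hω.decTime_eq h]
      exact ENat.natCast_lt_top _
  rw [FinPath.decimate, this, csSup_Iic]

lemma FinPath.HasSteps.segment (hω : ω.HasSteps (concatSteps bs)) {i : ℕ} (hi : i < bs.length) :
    (ω.segment N (i + 1)).HasSteps bs[i].2.steps := by
  have e1 : ω.decTime N (i + 1) = (blockTime bs (i + 1) : ℕ∞) := hω.decTime_eq hi
  have e0 : ω.decTime N i = (blockTime bs i : ℕ∞) := hω.decTime_eq hi.le
  have h2 : (0 : ℤ) < 2 ^ N := by positivity
  refine ⟨?_, fun k hk => ?_⟩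
  · simp only [FinPath.segment, Nat.add_sub_cancel, e1, e0, ENat.toNat_natCast, blockTime_succ hi]
    omega
  · simp only [FinPath.segment, Nat.add_sub_cancel, e1, e0, ENat.toNat_natCast]
    rw [hω.pos_blockTime_succ hi, hω.pos_blockTime hi, hω.pos_blockTime_add hi hk,
      add_sub_cancel_left, add_sub_cancel_left, Int.sign_mul, Int.sign_eq_one_of_pos h2]
    rcases Int.units_eq_one_or bs[i].1 with h | h <;> simp [h]

end Blocks

/-! ### Tree weights and the recursive masses -/

namespace PathTree

/-- The coarse steps of a path together with the corresponding pieces of the path. -/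
def blocks {N : ℕ} : PathTree (N + 1) → List (ℤˣ × PathTree N)
  | final a b => [(1, a), (1, b)]
  | exc e a b r => (e, a) :: (-e, b) :: r.blocks

lemma concatSteps_blocks {N : ℕ} : ∀ t : PathTree (N + 1), concatSteps t.blocks = t.steps
  | final a b => by simp [concatSteps, blocks, steps]
  | exc e a b r => by
    have := concatSteps_blocks r
    simp only [concatSteps] at this
    simp [concatSteps, blocks, steps, this]

lemma two_le_length_blocks {N : ℕ} : ∀ t : PathTree (N + 1), 2 ≤ t.blocks.length
  | final _ _ => by simp [blocks]
  | exc _ _ _ _ => by simp [blocks]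

/-- With `k` excursions there are `2k + 2` coarse steps and the factors multiply to `u^(2k)
x^(2k+1)`. There are always at least two blocks, so the natural subtractions do not truncate. -/
lemma weight_eq_blocks (u : ℝ) {N : ℕ} : ∀ t : PathTree (N + 1),
    t.weight u = u ^ (t.blocks.length - 2) * xParam u ^ (t.blocks.length - 1) *
      (t.blocks.map fun p => p.2.weight u).prod
  | final a b => by simp [weight, blocks]
  | exc e a b r => by
    have h := two_le_length_blocks r
    obtain ⟨k, hk⟩ := Nat.exists_eq_add_of_le h
    have ih := weight_eq_blocks u r
    simp only [weight, ih, blocks, List.length_cons, List.map_cons, List.prod_cons]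
    rw [hk, show 2 + k + 1 + 1 - 2 = k + 2 by omega, show 2 + k + 1 + 1 - 1 = k + 3 by omega,
      show 2 + k - 2 = k by omega, show 2 + k - 1 = k + 1 by omega]
    ring

lemma weight_level_zero (u : ℝ) (t : PathTree 0) : t.weight u = 1 := by
  cases t; rfl

lemma length_concatSteps_level_zero (bs : List (ℤˣ × PathTree 0)) :
    (concatSteps bs).length = bs.length := by
  induction bs with
  | nil => rfl
  | cons p bs ih =>
    obtain ⟨e, t⟩ := p
    cases t
    rw [concatSteps, List.flatMap_cons, List.length_append, signed_length, List.length_cons]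
    rw [concatSteps] at ih
    rw [ih]
    simp [steps]; omega

lemma massPlus_eq_weight (u : ℝ) {N : ℕ} {t : PathTree (N + 1)} {ω : FinPath}
    (h : ω.HasSteps t.steps) : massPlus u (N + 1) ω = t.weight u := by
  induction N generalizing ω with
  | zero =>
    rw [massPlus, weight_eq_blocks, h.len_eq, ← concatSteps_blocks,
      length_concatSteps_level_zero]
    simp [weight_level_zero]
  | succ N ih =>
    rw [← concatSteps_blocks] at h
    rw [massPlus, massPlus, weight_eq_blocks, h.decimate_len]
    congr 1
    rw [show Finset.Icc 1 t.blocks.length = Finset.Ico 1 (t.blocks.length + 1) by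
      ext; simp, Finset.prod_Ico_eq_prod_range, Nat.add_sub_cancel, Finset.prod_range,
      ← Fin.prod_univ_fun_getElem]
    refine Finset.prod_congr rfl fun i _ => ?_
    rw [add_comm 1 (i : ℕ)]
    exact ih (h.segment i.2)

lemma concatSteps_singleton {N : ℕ} (t : PathTree N) : concatSteps [(1, t)] = t.steps := by
  simp [concatSteps]

end PathTree

/-! ### Walks in `W_{N,±}` as trees -/

namespace FinPath

lemma HasSteps.isWalk {ω : FinPath} {l : List ℤ} (h : ω.HasSteps l) (hl : IsSteps l) :
    ω.IsWalk := by
  refine ⟨by simpa using h.pos_eq 0 (Nat.zero_le _), fun i hi => ?_⟩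
  rw [h.len_eq] at hi
  rw [h.pos_eq _ hi.le, h.pos_eq _ hi, List.sum_take_succ _ _ hi, sub_add_cancel_left, abs_neg]
  exact hl _ (List.getElem_mem hi)

lemma HasSteps.memPlus {N : ℕ} {t : PathTree N} {ω : FinPath} (h : ω.HasSteps t.steps) :
    ω.MemPlus N := by
  refine ⟨h.isWalk t.steps_isSteps, ?_, ?_⟩
  · have h' := h
    rw [← PathTree.concatSteps_singleton] at h'
    rw [h'.decTime_eq (i := 1) (by simp), h.len_eq]
    simp [blockTime, concatSteps]
  · rw [h.len_eq, h.pos_eq _ le_rfl, List.take_length, t.steps_sum]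

lemma IsWalk.exists_hasSteps {ω : FinPath} (h : ω.IsWalk) : ∃ l, IsSteps l ∧ ω.HasSteps l := by
  refine ⟨(List.range ω.len).map fun i => ω.pos (i + 1) - ω.pos i, ?_, by simp, fun i hi => ?_⟩
  · intro s hs
    obtain ⟨i, hi, rfl⟩ := List.mem_map.1 hs
    rw [abs_sub_comm]
    exact h.2 i (List.mem_range.1 hi)
  · rw [List.length_map, List.length_range] at hi
    induction i with
    | zero => simpa using h.1
    | succ i ih =>
      rw [List.sum_take_succ _ _ (by simpa using hi), ← ih (by omega)]
      simp

/-- The first exit from `(-2^N, 2^N)` is an admissible time in the definition of `T_1^N`, so a walk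
of length `T_1^N` has nothing after it. -/
lemma MemPlus.exists_hasSteps {N : ℕ} {ω : FinPath} (h : ω.MemPlus N) :
    ∃ t : PathTree N, ω.HasSteps t.steps := by
  obtain ⟨hw, hlen, hend⟩ := h
  obtain ⟨l, hl, hs⟩ := hw.exists_hasSteps
  have h2 : (0 : ℤ) < 2 ^ N := by positivity
  have hsum : l.sum = 2 ^ N := by
    rw [← hend, hs.len_eq, hs.pos_eq _ le_rfl, List.take_length]
  obtain ⟨e, p, r, hp, rfl⟩ := IsSteps.exists_firstPassage h2 hl (i := l.length) (by
    rw [List.take_length, hsum, abs_of_pos h2])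
  have hple : p.length ≤ (signed e p ++ r).length := by simp
  have hpos : ω.pos p.length = e * 2 ^ N := by
    rw [hs.pos_eq _ hple]
    rw [List.take_left' (signed_length e p), signed_sum, hp.sum_eq]
  have hne : p ≠ [] := by
    rintro rfl
    exact h2.ne hp.sum_eq
  have hle : ω.decTime N 1 ≤ (p.length : ℕ∞) := by
    refine sInf_le ⟨_, rfl, ?_, ?_, ?_, ?_⟩
    · simpa [decTime] using List.length_pos_iff.2 hne
    · rw [hs.len_eq]; exact hple
    · rw [hpos]; exact dvd_mul_left _ _
    · rw [hpos, decTime, ENat.toNat_zero, hw.1]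
      exact mul_ne_zero (Units.ne_zero _) h2.ne'
  have hr : r = [] := by
    rw [← hlen, Nat.cast_le, hs.len_eq, List.length_append, signed_length] at hle
    exact List.length_eq_zero_iff.1 (by omega)
  subst hr
  rw [List.append_nil] at hs hsum
  have he : e = 1 := by
    rcases Int.units_eq_one_or e with rfl | rfl
    · rfl
    · rw [signed_sum, hp.sum_eq] at hsum
      simp at hsum
      omega
  subst he
  obtain ⟨t, rfl⟩ := PathTree.exists_steps_eq hp
  exact ⟨t, by simpa using hs⟩

lemma decTime_neg (N : ℕ) (ω : FinPath) (i : ℕ) : ω.neg.decTime N i = ω.decTime N i := by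
  induction i with
  | zero => rfl
  | succ i ih =>
    rw [decTime, decTime, ih]
    simp [neg]

lemma memPlus_neg_iff {N : ℕ} {ω : FinPath} : ω.neg.MemPlus N ↔ ω.MemMinus N := by
  rw [MemPlus, MemMinus, decTime_neg]
  refine and_congr ?_ (and_congr Iff.rfl ?_)
  · simp only [IsWalk, neg, neg_eq_zero, ← neg_sub', abs_neg]
  · simp only [neg, neg_eq_iff_eq_neg]

end FinPath

/-! ### The law in terms of trees -/

/-- The infinite walks that start with the given steps. -/
def stepCylinder (l : List ℤ) : Set InfWalk := {η | ∀ i ≤ l.length, η.1 i = (l.take i).sum}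

lemma FinPath.HasSteps.cylinderOf_eq {ω : FinPath} {l : List ℤ} (h : ω.HasSteps l) :
    cylinderOf ω = stepCylinder l := by
  ext η
  simp only [cylinderOf, stepCylinder, mem_ofPred_eq, h.len_eq]
  exact forall₂_congr fun i hi => by rw [h.pos_eq i hi]

lemma FinPath.HasSteps.neg {ω : FinPath} {l : List ℤ} (h : ω.HasSteps l) :
    ω.neg.HasSteps (signed (-1) l) :=
  ⟨by simpa [FinPath.neg] using h.len_eq, fun i hi => by
    simpa [FinPath.neg] using h.pos_eq i (by simpa using hi)⟩

lemma FinPath.hasSteps_mk (l : List ℤ) : (FinPath.mk l.length fun i => (l.take i).sum).HasSteps l :=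
  ⟨rfl, fun _ _ => rfl⟩

lemma isDenkerHattoriLaw_iff {u : ℝ} {P : ProbabilityMeasure InfWalk} :
    IsDenkerHattoriLaw u P ↔ ∀ (N : ℕ) (e : ℤˣ) (t : PathTree (N + 1)),
      (P : Measure InfWalk) (stepCylinder (signed e t.steps)) = t.mass u / 2 := by
  have hm : ∀ {N : ℕ} (t : PathTree N), ENNReal.ofReal (t.weight u / 2) = t.mass u / 2 :=
    fun t => by rw [ENNReal.ofReal_div_of_pos two_pos, ENNReal.ofReal_ofNat, PathTree.mass]
  have hnn : ∀ ω : FinPath, ω.neg.neg = ω := fun ω => by simp [FinPath.neg]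
  constructor
  · intro h N e t
    have hs := FinPath.hasSteps_mk t.steps
    rcases Int.units_eq_one_or e with rfl | rfl
    · rw [signed_one, ← hs.cylinderOf_eq, (h (N + 1) (by omega) _).1 hs.memPlus,
        PathTree.massPlus_eq_weight u hs, hm]
    · have hs' := hs.neg
      rw [← hs'.cylinderOf_eq, (h (N + 1) (by omega) _).2
        (FinPath.memPlus_neg_iff.1 (by rw [hnn]; exact hs.memPlus)), massMinus, hnn,
        PathTree.massPlus_eq_weight u hs, hm]
  · intro h N hN ω
    obtain ⟨N, rfl⟩ := Nat.exists_eq_add_of_le' hN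
    constructor
    · intro hω
      obtain ⟨t, ht⟩ := hω.exists_hasSteps
      rw [ht.cylinderOf_eq, PathTree.massPlus_eq_weight u ht, hm, ← h N 1 t, signed_one]
    · intro hω
      obtain ⟨t, ht⟩ := (FinPath.memPlus_neg_iff.2 hω).exists_hasSteps
      have ht' := ht.neg
      rw [hnn] at ht'
      rw [ht'.cylinderOf_eq, massMinus, PathTree.massPlus_eq_weight u ht, hm, ← h N (-1) t]

/-! ### Cylinders over first-passage paths -/

/-- Clopen sets have empty frontier, so their masses pass to weak limits. -/
lemma isClopen_stepCylinder (l : List ℤ) : IsClopen (stepCylinder l) := by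
  have : stepCylinder l = ⋂ i ∈ Finset.range (l.length + 1),
      (fun η : InfWalk => η.1 i) ⁻¹' {(l.take i).sum} := by
    ext η
    simp [stepCylinder]
  rw [this]
  refine isClopen_biInter_finset fun i _ => (isClopen_discrete _).preimage ?_
  exact (continuous_apply i).comp continuous_subtype_val

lemma measurableSet_stepCylinder (l : List ℤ) : MeasurableSet (stepCylinder l) :=
  (isClopen_stepCylinder l).isClosed.measurableSet

lemma stepCylinder_append_subset (l r : List ℤ) : stepCylinder (l ++ r) ⊆ stepCylinder l := by
  intro η hη i hi
  rw [hη i (by simp; omega), List.take_append_of_le_length hi]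

lemma List.take_eq_of_sum_take_eq {l l' : List ℤ} (hle : l.length ≤ l'.length)
    (h : ∀ i ≤ l.length, (l.take i).sum = (l'.take i).sum) : l'.take l.length = l := by
  refine List.ext_getElem (by simpa using hle) fun i h1 h2 => ?_
  have h3 := h (i + 1) h2
  rw [List.sum_take_succ _ _ h2, List.sum_take_succ _ _ (h2.trans_le hle), h i h2.le] at h3
  rw [List.getElem_take]
  exact (add_left_cancel h3).symm

namespace PathTree

/-- The infinite walks whose initial piece is the path described by a tree, up to a sign. -/
def cyl {N : ℕ} (p : ℤˣ × PathTree N) : Set InfWalk := stepCylinder (signed p.1 p.2.steps)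

lemma measurableSet_cyl {N : ℕ} (p : ℤˣ × PathTree N) : MeasurableSet (cyl p) :=
  measurableSet_stepCylinder _

/-- Two initial pieces of one walk are prefixes of each other, and unique decoding rules out proper
prefixes. -/
lemma eq_of_mem_cyl {N : ℕ} {p q : ℤˣ × PathTree N} {η : InfWalk} (hp : η ∈ cyl p)
    (hq : η ∈ cyl q) : p = q := by
  wlog hle : p.2.steps.length ≤ q.2.steps.length generalizing p q
  · exact (this hq hp (not_le.1 hle).le).symm
  have h1 : (signed q.1 q.2.steps).take (signed p.1 p.2.steps).length = signed p.1 p.2.steps := by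
    refine List.take_eq_of_sum_take_eq (by simpa using hle) fun i hi => ?_
    rw [← hp i hi, ← hq i (hi.trans (by simpa using hle))]
  have h2 := List.take_append_drop (signed p.1 p.2.steps).length (signed q.1 q.2.steps)
  rw [h1] at h2
  obtain ⟨h3, h4, -⟩ := steps_append_inj (s := []) (h2.trans (List.append_nil _).symm)
  exact Prod.ext h3 (steps_injective h4)

lemma pairwise_disjoint_cyl (N : ℕ) :
    Pairwise (Function.onFun Disjoint (cyl : ℤˣ × PathTree N → Set InfWalk)) := fun _ _ hpq =>
  Set.disjoint_left.2 fun _ hp hq => hpq (eq_of_mem_cyl hp hq)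

lemma tsum_signed_mass (u : ℝ) (N : ℕ) : ∑' p : ℤˣ × PathTree N, p.2.mass u / 2 = 1 := by
  rw [ENNReal.tsum_prod', tsum_intUnits]
  simp only [div_eq_mul_inv, ENNReal.tsum_mul_right, tsum_mass, one_mul]
  exact ENNReal.inv_two_add_inv_two

/-- The first piece of a path of level `N + 1` is a path of level `N`. The paths with a given
first piece are parametrized by the rest of the path. -/
def extend {N : ℕ} (p : ℤˣ × PathTree N) :
    PathTree N ⊕ (PathTree (N + 1) × ℤˣ × PathTree N) → ℤˣ × PathTree (N + 1)
  | Sum.inl b => (p.1, final p.2 b)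
  | Sum.inr (r, e, b) => (p.1 * e, exc e p.2 b r)

lemma extend_injective {N : ℕ} (p : ℤˣ × PathTree N) : Function.Injective (extend p) := by
  rintro (b | ⟨r, e, b⟩) (b' | ⟨r', e', b'⟩) h <;> simp_all [extend]

/-- In the excursion case the overall sign `p.1 * e` cancels against the sign `e` of the first
block, leaving `p.1`. -/
lemma cyl_extend_subset {N : ℕ} (p : ℤˣ × PathTree N)
    (s : PathTree N ⊕ (PathTree (N + 1) × ℤˣ × PathTree N)) : cyl (extend p s) ⊆ cyl p := by
  rcases s with b | ⟨r, e, b⟩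
  · rw [cyl, extend, steps, signed_append]
    exact stepCylinder_append_subset _ _
  · rw [cyl, extend, steps, signed_append, signed_signed, mul_assoc, Int.units_mul_self, mul_one]
    exact stepCylinder_append_subset _ _

lemma tsum_mass_extend (u : ℝ) {N : ℕ} (p : ℤˣ × PathTree N) :
    ∑' s, (extend p s).2.mass u / 2 = p.2.mass u / 2 := by
  have h0 := xParam_pos u
  have h1 := xParam_le_one u
  have hA : 0 ≤ (1 - xParam u) / 2 := by linarith
  have hsum : ENNReal.ofReal (xParam u) +
      (ENNReal.ofReal ((1 - xParam u) / 2) + ENNReal.ofReal ((1 - xParam u) / 2)) = 1 := by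
    rw [← ENNReal.ofReal_add hA hA, ← ENNReal.ofReal_add h0.le (by linarith),
      ← ENNReal.ofReal_one]
    congr 1; ring
  rw [ENNReal.summable.tsum_sum (by exact ENNReal.summable)]
  simp only [extend, mass_final, mass_exc, ENNReal.tsum_prod', tsum_intUnits, div_eq_mul_inv,
    ENNReal.tsum_mul_right, ENNReal.tsum_mul_left, tsum_mass, mul_one] at hsum ⊢
  rw [← add_mul, mul_left_comm, ← mul_assoc, mul_comm _ (mass u p.2), mul_assoc, ← mul_add,
    one_add_one_eq_two, mul_two, hsum, mul_one]

/-- The disjoint extensions of `p` give the lower bound. The prescribed masses already sum to `1`,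
so a strict inequality anywhere would push the total above `1`. -/
lemma measure_cyl_of_succ {u : ℝ} {P : Measure InfWalk} [IsProbabilityMeasure P] {N : ℕ}
    (h : ∀ p : ℤˣ × PathTree (N + 1), P (cyl p) = p.2.mass u / 2) (p : ℤˣ × PathTree N) :
    P (cyl p) = p.2.mass u / 2 := by
  have hle : ∀ p : ℤˣ × PathTree N, p.2.mass u / 2 ≤ P (cyl p) := fun p => by
    rw [← tsum_mass_extend]
    simp_rw [← h]
    rw [← measure_iUnion (f := fun s => cyl (extend p s))
      (fun s t hst => pairwise_disjoint_cyl _ ((extend_injective p).ne hst))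
      fun s => measurableSet_cyl _]
    exact measure_mono (iUnion_subset fun s => cyl_extend_subset p s)
  by_contra hne
  have hlt := ENNReal.tsum_lt_tsum (by rw [tsum_signed_mass]; exact ENNReal.one_ne_top) hle
    ((hle p).lt_of_ne' hne)
  rw [tsum_signed_mass, ← measure_iUnion (pairwise_disjoint_cyl N) measurableSet_cyl] at hlt
  exact absurd prob_le_one (not_le.2 hlt)

lemma measure_cyl_of_le {u : ℝ} {P : Measure InfWalk} [IsProbabilityMeasure P] {M N : ℕ}
    (hMN : M ≤ N) (h : ∀ p : ℤˣ × PathTree N, P (cyl p) = p.2.mass u / 2) :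
    ∀ p : ℤˣ × PathTree M, P (cyl p) = p.2.mass u / 2 := by
  induction hMN with
  | refl => exact h
  | step _ ih => exact ih fun p => measure_cyl_of_succ h p

lemma measure_iUnion_cyl {u : ℝ} {P : Measure InfWalk} {N : ℕ}
    (h : ∀ p : ℤˣ × PathTree N, P (cyl p) = p.2.mass u / 2) : P (⋃ p, cyl (N := N) p) = 1 := by
  rw [measure_iUnion (pairwise_disjoint_cyl N) measurableSet_cyl]
  simp_rw [h, tsum_signed_mass]

/-! ### Existence of the law -/

/-- The walk with given steps, continued by steps `+1`. -/
def continuation (l : List ℤ) (hl : IsSteps l) : InfWalk :=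
  ⟨fun i => (l.take i).sum + ((i - l.length : ℕ) : ℤ), by simp, fun i => by
    dsimp only
    rcases lt_or_ge i l.length with h | h
    · have := hl _ (List.getElem_mem h)
      rw [List.sum_take_succ _ _ h, Nat.sub_eq_zero_of_le h.le, Nat.sub_eq_zero_of_le h]
      simpa using this
    · rw [List.take_of_length_le h, List.take_of_length_le (h.trans (Nat.le_succ i)),
        Nat.succ_sub h]
      simp⟩

lemma continuation_mem (l : List ℤ) (hl : IsSteps l) : continuation l hl ∈ stepCylinder l :=
  fun i hi => by simp [continuation, Nat.sub_eq_zero_of_le hi]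

/-- A law on infinite walks that gives the right mass to the cylinders of level `N`. -/
noncomputable def levelLaw (u : ℝ) (N : ℕ) : Measure InfWalk :=
  Measure.sum fun p : ℤˣ × PathTree N =>
    (p.2.mass u / 2) • Measure.dirac (continuation _ (isSteps_signed p.2.steps_isSteps p.1))

lemma levelLaw_cyl (u : ℝ) {N : ℕ} (p : ℤˣ × PathTree N) :
    levelLaw u N (cyl p) = p.2.mass u / 2 := by
  rw [levelLaw, Measure.sum_apply _ (measurableSet_cyl p), tsum_eq_single p fun q hq => ?_]
  · rw [Measure.smul_apply, Measure.dirac_apply_of_mem (by exact continuation_mem _ _), smul_eq_mul,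
      mul_one]
  · rw [Measure.smul_apply, Measure.dirac_apply' _ (measurableSet_cyl p), indicator_of_notMem,
      smul_zero]
    exact fun h => hq (eq_of_mem_cyl (continuation_mem _ _) h)

instance (u : ℝ) (N : ℕ) : IsProbabilityMeasure (levelLaw u N) := by
  constructor
  rw [levelLaw, Measure.sum_apply _ MeasurableSet.univ]
  simpa using tsum_signed_mass u N

end PathTree

/-- Since `|ω i| ≤ i`, the walks form a closed subset of a product of finite intervals. -/
instance : CompactSpace InfWalk := by
  refine ⟨?_⟩
  rw [IsEmbedding.subtypeVal.isCompact_iff, image_univ, Subtype.range_coe_subtype]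
  refine (isCompact_univ_pi fun i : ℕ => isCompact_Icc (a := -(i : ℤ)) (b := i)).of_isClosed_subset
    ?_ fun ω hω i _ => ?_
  · have : {ω : ℕ → ℤ | ω 0 = 0 ∧ ∀ i, |ω i - ω (i + 1)| = 1} =
        {ω | ω 0 = 0} ∩ ⋂ i, {ω | |ω i - ω (i + 1)| = 1} := by
      ext; simp
    rw [this]
    exact (isClosed_eq (by fun_prop) (by fun_prop)).inter
      (isClosed_iInter fun i => isClosed_eq (by fun_prop) (by fun_prop))
  · rw [mem_Icc, ← abs_le]
    induction i with
    | zero => simp [hω.1]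
    | succ i ih =>
      have h1 := hω.2 i
      have h2 := ih (mem_univ i)
      have h3 := abs_sub_abs_le_abs_sub (ω (i + 1)) (ω i)
      rw [abs_sub_comm, h1] at h3
      push_cast
      linarith

/-- A limit point of the discrete laws `levelLaw u M` works: by consistency, the mass of a fixed
cylinder is already correct for all large `M`. -/
lemma exists_isDenkerHattoriLaw (u : ℝ) : ∃ P : ProbabilityMeasure InfWalk,
    IsDenkerHattoriLaw u P := by
  have : TopologicalSpace.PseudoMetrizableSpace InfWalk :=
    IsInducing.pseudoMetrizableSpace (f := fun η : InfWalk => η.1) ⟨rfl⟩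
  let := TopologicalSpace.pseudoMetrizableSpacePseudoMetric InfWalk
  let Q : ℕ → ProbabilityMeasure InfWalk := fun N => ⟨PathTree.levelLaw u N, inferInstance⟩
  obtain ⟨P, -, hP⟩ := isCompact_univ.ultrafilter_le_nhds ((hyperfilter ℕ).map Q) (by simp)
  refine ⟨P, isDenkerHattoriLaw_iff.2 fun N e t => ?_⟩
  have h1 : Tendsto Q (hyperfilter ℕ) (𝓝 P) := hP
  have h2 := ProbabilityMeasure.tendsto_measure_of_null_frontier_of_tendsto' h1
    (E := PathTree.cyl (e, t)) (by
      rw [PathTree.cyl, (isClopen_stepCylinder _).frontier_eq, measure_empty])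
  refine tendsto_nhds_unique h2 (tendsto_const_nhds.congr' ?_)
  have h3 : ∀ᶠ M in (hyperfilter ℕ : Filter ℕ), N + 1 ≤ M :=
    (Nat.cofinite_eq_atTop ▸ hyperfilter_le_cofinite) (eventually_ge_atTop (N + 1))
  filter_upwards [h3] with M hM
  exact (PathTree.measure_cyl_of_le (P := PathTree.levelLaw u M) hM
    (PathTree.levelLaw_cyl u) (e, t)).symm

/-! ### The law of the range -/

namespace PathTree

lemma walkRange_of_mem_cyl {N : ℕ} {p : ℤˣ × PathTree N} {η : InfWalk} (h : η ∈ cyl p) :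
    walkRange N η = 2 ^ N + p.2.low := by
  obtain ⟨e, t⟩ := p
  have hfp := t.firstPassage_steps
  have hlen : (signed e t.steps).length = t.steps.length := signed_length _ _
  have hset : {x : ℤ | ∃ j : ℕ, η.1 j = x ∧ ∀ i ≤ j, η.1 i ≠ 2 ^ N ∧ η.1 i ≠ -2 ^ N} =
      visited (signed e t.steps) := by
    ext z
    constructor
    · rintro ⟨j, rfl, hj⟩
      have hjlt : j < t.steps.length := by
        by_contra hge
        have h1 := hj t.steps.length (not_lt.1 hge)
        rw [h _ hlen.ge, signed_take, List.take_length, signed_sum, steps_sum] at h1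
        rcases Int.units_eq_one_or e with rfl | rfl <;> simp at h1
      exact ⟨j, hlen ▸ hjlt, (h j (hlen ▸ hjlt.le)).symm⟩
    · rintro ⟨j, hj, rfl⟩
      refine ⟨j, h j hj.le, fun i hi => ?_⟩
      have h1 := hfp.abs_lt i (hi.trans_lt (hlen ▸ hj))
      rw [h i (hi.trans hj.le), signed_take, signed_sum]
      rw [← abs_unit_mul e, abs_lt] at h1
      exact ⟨h1.2.ne, h1.1.ne'⟩
  have h1 : (0 : ℤ) < 2 ^ N := by positivity
  rw [walkRange, hset, visited_signed, visited_steps,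
    ncard_image_of_injective _ (mul_right_injective₀ (Units.ne_zero e)), ← Finset.coe_Icc,
    ncard_coe_finset, Int.card_Icc]
  zify
  rw [Int.toNat_of_nonneg (by linarith)]
  ring

/-- The rescaled excess range. -/
noncomputable def excess (n : ℕ) (η : InfWalk) : ℝ := (walkRange n η : ℝ) / 2 ^ n - 1

lemma excess_of_mem_cyl {N : ℕ} {p : ℤˣ × PathTree N} {η : InfWalk} (h : η ∈ cyl p) :
    excess N η = p.2.relLow := by
  rw [excess, walkRange_of_mem_cyl h, relLow]
  push_cast
  rw [add_div, div_self (by positivity), add_sub_cancel_left]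

section Law

variable {u : ℝ} {P : Measure InfWalk} [IsProbabilityMeasure P] {N : ℕ}

lemma ae_mem_cyl (h : ∀ p : ℤˣ × PathTree N, P (cyl p) = p.2.mass u / 2) : ∀ᵐ η ∂P, ∃ p :
    ℤˣ × PathTree N, η ∈ cyl p := by
  have := (prob_compl_eq_zero_iff (MeasurableSet.iUnion measurableSet_cyl)).2 (measure_iUnion_cyl h)
  filter_upwards [compl_mem_ae_iff.2 this] with η hη
  simpa using hη

/-- The excess is constant on each of the countably many cylinders, which cover almost every walk.
-/
lemma aemeasurable_excess (h : ∀ p : ℤˣ × PathTree N, P (cyl p) = p.2.mass u / 2) : AEMeasurable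
    (excess N) P := by
  have h1 : P.restrict (⋃ p, cyl (N := N) p) = P :=
    Measure.restrict_eq_self_of_ae_mem (by simpa using ae_mem_cyl h)
  rw [← h1, aemeasurable_iUnion_iff]
  refine fun p => (aemeasurable_const (b := p.2.relLow)).congr ?_
  filter_upwards [ae_restrict_mem (measurableSet_cyl p)] with η hη
  exact (excess_of_mem_cyl hη).symm

lemma measure_excess_le (h : ∀ p : ℤˣ × PathTree N, P (cyl p) = p.2.mass u / 2) (y : ℝ) :
    P (excess N ⁻¹' Iic y) = ENNReal.ofReal (approxCdf (xParam u) N y) := by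
  classical
  have h1 : (excess N ⁻¹' Iic y : Set InfWalk) =ᵐ[P]
      ⋃ p : ℤˣ × PathTree N, if p.2.relLow ≤ y then cyl p else ∅ := by
    filter_upwards [ae_mem_cyl h] with η hη
    obtain ⟨p, hp⟩ := hη
    refine propext ?_
    change excess N η ≤ y ↔ η ∈ ⋃ p : ℤˣ × PathTree N, if p.2.relLow ≤ y then cyl p else ∅
    rw [excess_of_mem_cyl hp, mem_iUnion]
    constructor
    · intro hy
      exact ⟨p, by rwa [if_pos hy]⟩
    · rintro ⟨q, hq⟩
      split_ifs at hq with hy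
      · rwa [eq_of_mem_cyl hp hq]
      · exact hq.elim
  rw [measure_congr h1, measure_iUnion, ← tsum_massLe]
  · have h2 : ∀ p : ℤˣ × PathTree N,
        P (if p.2.relLow ≤ y then cyl p else ∅) = massLe u y p.2 / 2 := fun p => by
      unfold massLe
      split_ifs
      · exact h p
      · simp
    simp_rw [h2]
    rw [ENNReal.tsum_prod', tsum_intUnits]
    simp only [div_eq_mul_inv, ENNReal.tsum_mul_right]
    rw [← mul_add, ENNReal.inv_two_add_inv_two, mul_one]
  · intro p q hpq
    refine (pairwise_disjoint_cyl N hpq).mono ?_ ?_ <;> dsimp only <;> split_ifs <;> simp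
  · intro p
    split_ifs
    · exact measurableSet_cyl p
    · exact MeasurableSet.empty

end Law

end PathTree

lemma tendstoInDistribution_excess {u : ℝ} {P : ProbabilityMeasure InfWalk}
    (hP : IsDenkerHattoriLaw u P) :
    TendstoInDistribution (fun (n : ℕ) (ω : InfWalk) => (walkRange n ω : ℝ) / 2 ^ n - 1) atTop
      (id : ℝ → ℝ) (fun _ => (P : Measure InfWalk))
      (limitLaw (xParam u) (xParam_pos u) (xParam_le_one u) : Measure ℝ) := by
  -- The law prescribes masses only from level `1` on; descending from level `N + 1` to `N` includes
  -- level `0`.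
  have h : ∀ (N : ℕ) (p : ℤˣ × PathTree N), (P : Measure InfWalk) (PathTree.cyl p) =
      p.2.mass u / 2 := fun N =>
    PathTree.measure_cyl_of_le N.le_succ fun p => isDenkerHattoriLaw_iff.1 hP N p.1 p.2
  refine ⟨fun n => PathTree.aemeasurable_excess (h n), aemeasurable_id,
    tendsto_probabilityMeasure_of_tendsto_cdf fun y => ?_⟩
  have h1 : ∀ n, cdf ((P : Measure InfWalk).map (PathTree.excess n)) y =
      approxCdf (xParam u) n y := fun n => by
    have hm := PathTree.aemeasurable_excess (h n)
    have := Measure.isProbabilityMeasure_map hm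
    rw [cdf_eq_real, measureReal_def, Measure.map_apply_of_aemeasurable hm measurableSet_Iic,
      PathTree.measure_excess_le (h n),
      ENNReal.toReal_ofReal (approxCdf_mem (xParam_pos u) (xParam_le_one u) n y).1]
  have h2 : cdf ((limitLaw (xParam u) (xParam_pos u) (xParam_le_one u) : Measure ℝ).map id) y =
      limitCdf (xParam u) y := by rw [Measure.map_id, cdf_limitLaw]
  have h3 := approxCdf_tendsto (xParam_pos u) (xParam_le_one u) y
  rw [← h2] at h3
  exact h3.congr fun n => (h1 n).symm

theorem theorem1p2 (u : ℝ) (hu : 0 ≤ u) :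
    (∃ P : ProbabilityMeasure InfWalk, IsDenkerHattoriLaw u P) ∧
    ∃ μ : ProbabilityMeasure ℝ,
      (μ : Measure ℝ) (Icc (0 : ℝ) 1) = 1 ∧
      (∀ P : ProbabilityMeasure InfWalk, IsDenkerHattoriLaw u P →
        TendstoInDistribution
          (fun (n : ℕ) (ω : InfWalk) => (walkRange n ω : ℝ) / 2 ^ n - 1) atTop
          (id : ℝ → ℝ) (fun _ => (P : Measure InfWalk)) (μ : Measure ℝ)) ∧
      (0 < u → SatisfiesDeRham u (fun x => cdf (μ : Measure ℝ) x)) ∧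
      (u = 1 → (μ : Measure ℝ) ≪ volume.restrict (Icc (0 : ℝ) 1)) ∧
      (u ≠ 1 → (μ : Measure ℝ) ⟂ₘ volume.restrict (Icc (0 : ℝ) 1)) := by
  refine ⟨exists_isDenkerHattoriLaw u, limitLaw (xParam u) (xParam_pos u) (xParam_le_one u),
    limitLaw_Icc _ _, fun P hP => tendstoInDistribution_excess hP, fun h => ?_, ?_, fun h => ?_⟩
  · simp_rw [cdf_limitLaw]
    exact satisfiesDeRham_limitCdf h
  · rintro rfl
    exact limitLaw_half_absolutelyContinuous _ _ xParam_one
  · rcases hu.eq_or_lt with rfl | h0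
    · exact limitLaw_one_mutuallySingular _ _ xParam_zero
    · exact limitLaw_mutuallySingular (xParam_pos u) (xParam_lt_one h0.ne')
        fun hx => h (eq_one_of_xParam_eq_half hu hx)
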